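/- Let $\Gamma$ be a finitely generated group and let $n\ge 1$ be an integer. Let $\mathbb{C}[\mathrm{Hom}(\Gamma,\mathrm{GL}(n,\mathbb{C}))]$ be the algebra of regular functions on the affine algebraic set $\mathrm{Hom}(\Gamma,\mathrm{GL}(n,\mathbb{C}))$ (generated by the matrix entries $\rho\mapsto\rho(\gamma)_{ij}$), and let the $\mathrm{GL}(n,\mathbb{C})$-character variety $\mathcal{X}_{\mathrm{GL}(n,\mathbb{C})}(\Gamma)$ be the set of complex points of the GIT quotient by conjugation, i.e. of $\mathrm{Spec}\,\mathbb{C}[\mathrm{Hom}(\Gamma,\mathrm{GL}(n,\mathbb{C}))]^{\mathrm{GL}(n,\mathbb{C})}$. For $\rho\in\mathrm{Hom}(\Gamma,\mathrm{GL}(n,\mathbb{C}))$ let $\chi_\rho$ denote its image in $\mathcal{X}_{\mathrm{GL}(n,\mathbb{C})}(\Gamma)$. Let $\Phi_2$ be the anti-holomorphic involution of $\mathcal{X}_{\mathrm{GL}(n,\mathbb{C})}(\Gamma)$ induced by $A\mapsto ({}^t\overline{A})^{-1}$, so that $\Phi_2(\chi_\rho)=\chi_{\rho'}$ with $\rho'(\gamma)=({}^t\overline{\rho(\gamma)})^{-1}$,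 and let $\mathcal{X}^{\Phi_2}_{\mathrm{GL}(n,\mathbb{C})}(\Gamma)$ be its set of fixed points. For $p,q\ge 0$ with $p+q=n$ let $I_{p,q}=\mathrm{diag}(I_p,-I_q)$ and $\mathrm{U}(p,q)=\{M\in\mathrm{GL}(n,\mathbb{C}) : {}^t\overline{M}I_{p,q}M=I_{p,q}\}$, and let the $\mathrm{U}(p,q)$-character variety be $\mathcal{X}_{\mathrm{U}(p,q)}(\Gamma)=\{\chi_\rho : \rho\in\mathrm{Hom}(\Gamma,\mathrm{U}(p,q))\}\subset\mathcal{X}_{\mathrm{GL}(n,\mathbb{C})}(\Gamma)$. Then $$\mathcal{X}^{\Phi_2}_{\mathrm{GL}(n,\mathbb{C})}(\Gamma)=\bigcup_{p+q=n}\mathcal{X}_{\mathrm{U}(p,q)}(\Gamma).$$ Moreover, if $\rho\in\mathrm{Hom}(\Gamma,\mathrm{GL}(n,\mathbb{C}))$ is semisimple and $\Phi_2(\chi_\rho)=\chi_\rho$, then there exist $p,q\ge 0$ with $p+q=n$ such that $\rho$ is conjugate in $\mathrm{GL}(n,\mathbb{C})$ to a representation with values in $\mathrm{U}(p,q)$.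 -/

import Mathlib

open Matrix

noncomputable section

namespace CharVar

/-- The representation variety `Hom(Γ, GL(n, ℂ))`. -/
abbrev RepVar (Γ : Type*) [Group Γ] (n : ℕ) : Type _ :=
  Γ →* GL (Fin n) ℂ

/-- The action of `GL(n, ℂ)` on `Hom(Γ, GL(n, ℂ))` by conjugation:
`(conjRep g ρ) γ = g * ρ γ * g⁻¹`. -/
def conjRep {Γ : Type*} [Group Γ] {n : ℕ} (g : GL (Fin n) ℂ) (ρ : RepVar Γ n) : RepVar Γ n :=
  (MulAut.conj g).toMonoidHom.comp ρ

/-- The ring `ℂ[Hom(Γ, GL(n, ℂ))]` of regular functions on the representation variety, as an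
algebra of functions: it is generated by the matrix entries `ρ ↦ (ρ γ) i j`. If `γ₁, …, γₛ`
generate `Γ`, these are exactly the restrictions to `Hom(Γ, GL(n, ℂ)) ⊆ GL(n, ℂ)ˢ` of the
polynomials in the entries of the `ρ(γₖ)` and in the `det(ρ(γₖ))⁻¹`. -/
def regularFunctions (Γ : Type*) [Group Γ] (n : ℕ) : Subalgebra ℂ (RepVar Γ n → ℂ) :=
  Algebra.adjoin ℂ {f | ∃ (γ : Γ) (i j : Fin n), f = fun ρ => (ρ γ : Matrix (Fin n) (Fin n) ℂ) i j}

/-- The ring `ℂ[Hom(Γ, GL(n, ℂ))]^GL(n, ℂ)` of regular functions invariant under conjugation. -/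
def invariantFunctions (Γ : Type*) [Group Γ] (n : ℕ) : Subalgebra ℂ (RepVar Γ n → ℂ) where
  carrier := {f | f ∈ regularFunctions Γ n ∧ ∀ g ρ, f (conjRep g ρ) = f ρ}
  mul_mem' := fun ha hb => ⟨mul_mem ha.1 hb.1, fun g ρ => by simp [ha.2 g ρ, hb.2 g ρ]⟩
  add_mem' := fun ha hb => ⟨add_mem ha.1 hb.1, fun g ρ => by simp [ha.2 g ρ, hb.2 g ρ]⟩
  algebraMap_mem' := fun r => ⟨Subalgebra.algebraMap_mem _ r, fun _ _ => rfl⟩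

/-- The `GL(n, ℂ)`-character variety of `Γ`, as an algebraic set: the complex points of the GIT
quotient `Spec(ℂ[Hom(Γ, GL(n, ℂ))]^GL(n, ℂ))`, that is, the `ℂ`-algebra homomorphisms from the ring
of invariant functions to `ℂ`. -/
abbrev CharacterVariety (Γ : Type*) [Group Γ] (n : ℕ) : Type _ :=
  invariantFunctions Γ n →ₐ[ℂ] ℂ

/-- The projection `ρ ↦ χ_ρ` from `Hom(Γ, GL(n, ℂ))` to the character variety: the point `χ_ρ` is
evaluation of invariant functions at `ρ`. -/
def chi {Γ : Type*} [Group Γ] {n : ℕ} (ρ : RepVar Γ n) : CharacterVariety Γ n :=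
  (Pi.evalAlgHom ℂ (fun _ : RepVar Γ n => ℂ) ρ).comp (invariantFunctions Γ n).val

/-- The character variety of `Γ` for a subgroup `H` of `GL(n, ℂ)`: the image of `Hom(Γ, H)` in the
`GL(n, ℂ)`-character variety. -/
def subgroupCharacterVariety (Γ : Type*) [Group Γ] {n : ℕ} (H : Subgroup (GL (Fin n) ℂ)) :
    Set (CharacterVariety Γ n) :=
  Set.range fun σ : Γ →* H => chi (H.subtype.comp σ)

/-- The involution `A ↦ (Āᵗ)⁻¹` of `GL(n, ℂ)`. -/
def phi₂GL (n : ℕ) : GL (Fin n) ℂ →* GL (Fin n) ℂ where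
  toFun A := (star A)⁻¹
  map_one' := by simp
  map_mul' A B := by simp

theorem coe_phi₂GL {n : ℕ} (A : GL (Fin n) ℂ) :
    (phi₂GL n A : Matrix (Fin n) (Fin n) ℂ) = ((A : Matrix (Fin n) (Fin n) ℂ)ᴴ)⁻¹ := by
  simp [phi₂GL, Matrix.coe_units_inv, Matrix.star_eq_conjTranspose, Matrix.conjTranspose_nonsing_inv]

/-- The involution `ρ ↦ (γ ↦ phi₂GL (ρ γ))` of `Hom(Γ, GL(n, ℂ))`. -/
def phi₂Rep {Γ : Type*} [Group Γ] {n : ℕ} (ρ : RepVar Γ n) : RepVar Γ n :=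
  (phi₂GL n).comp ρ

/-- If `f` is an invariant regular function, then so is `ρ ↦ conj (f (phi₂Rep ρ))`. -/
theorem conj_comp_phi₂Rep_mem {Γ : Type*} [Group Γ] {n : ℕ} {f : RepVar Γ n → ℂ}
    (hf : f ∈ invariantFunctions Γ n) :
    (fun ρ => star (f (phi₂Rep ρ))) ∈ invariantFunctions Γ n := by
  refine ⟨?_, fun g ρ => ?_⟩
  · have h : f ∈ regularFunctions Γ n := hf.1
    clear hf
    unfold regularFunctions at h
    induction h using Algebra.adjoin_induction with
    | mem x hx =>
      obtain ⟨γ, i, j, rfl⟩ := hx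
      refine Algebra.subset_adjoin ⟨γ⁻¹, j, i, funext fun ρ => ?_⟩
      have : phi₂GL n (ρ γ) = star (ρ γ⁻¹) := by simp [phi₂GL]
      simp [phi₂Rep, this]
    | algebraMap r => exact Subalgebra.algebraMap_mem _ (star r)
    | add x y _ _ hx hy =>
      convert add_mem hx hy using 1
      funext ρ
      simp
    | mul x y _ _ hx hy =>
      convert mul_mem hx hy using 1
      funext ρ
      simp
  · have : phi₂Rep (conjRep g ρ) = conjRep (phi₂GL n g) (phi₂Rep ρ) := by
      ext1 γ
      simp [phi₂Rep, conjRep]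
    simp only [this, hf.2]

/-- The anti-holomorphic involution `Φ₂` of the character variety induced by `A ↦ (Āᵗ)⁻¹`. On the
points `χ_ρ` it is `χ_ρ ↦ χ_{phi₂Rep ρ}`, see `Phi₂_chi`. -/
def Phi₂ {Γ : Type*} [Group Γ] {n : ℕ} (x : CharacterVariety Γ n) : CharacterVariety Γ n where
  toFun f := star (x ⟨fun ρ => star ((f : RepVar Γ n → ℂ) (phi₂Rep ρ)),
    conj_comp_phi₂Rep_mem f.2⟩)
  map_one' := by
    rw [← star_one ℂ, ← map_one x]
    congr 2
    ext ρ
    simp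
  map_mul' a b := by
    rw [← star_mul', ← map_mul]
    congr 2
    ext ρ
    simp
  map_zero' := by
    rw [← star_zero ℂ, ← map_zero x]
    congr 2
    ext ρ
    simp
  map_add' a b := by
    rw [← star_add, ← map_add]
    congr 2
    ext ρ
    simp
  commutes' r := by
    rw [← star_star (algebraMap ℂ ℂ r)]
    congr 1
    exact x.commutes (star r)

theorem Phi₂_chi {Γ : Type*} [Group Γ] {n : ℕ} (ρ : RepVar Γ n) :
    Phi₂ (chi ρ) = chi (phi₂Rep ρ) := by
  ext f
  exact star_star _

/-- The block matrix `I_{p,q} = diag(I_p, -I_q)` of size `n = p + q`. -/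
def Ipq {n : ℕ} (p q : ℕ) (h : p + q = n) : Matrix (Fin n) (Fin n) ℂ :=
  Matrix.reindex (finSumFinEquiv.trans (finCongr h)) (finSumFinEquiv.trans (finCongr h))
    (Matrix.fromBlocks (1 : Matrix (Fin p) (Fin p) ℂ) 0 0 (-1 : Matrix (Fin q) (Fin q) ℂ))

/-- The group `U(p,q) = {M ∈ GL(n, ℂ) | M̄ᵗ I_{p,q} M = I_{p,q}}`, where `n = p + q`. -/
def Upq {n : ℕ} (p q : ℕ) (h : p + q = n) : Subgroup (GL (Fin n) ℂ) where
  carrier := {M | (M : Matrix (Fin n) (Fin n) ℂ)ᴴ * Ipq p q h * M = Ipq p q h}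
  one_mem' := by simp
  mul_mem' := fun {A B} hA hB => by
    have hA : (A : Matrix (Fin n) (Fin n) ℂ)ᴴ * Ipq p q h * A = Ipq p q h := hA
    have hB : (B : Matrix (Fin n) (Fin n) ℂ)ᴴ * Ipq p q h * B = Ipq p q h := hB
    calc ((A * B : GL (Fin n) ℂ) : Matrix (Fin n) (Fin n) ℂ)ᴴ * Ipq p q h * (A * B : GL (Fin n) ℂ)
        = (B : Matrix (Fin n) (Fin n) ℂ)ᴴ *
            ((A : Matrix (Fin n) (Fin n) ℂ)ᴴ * Ipq p q h * A) * B := by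
          simp [Matrix.conjTranspose_mul, Matrix.mul_assoc]
      _ = Ipq p q h := by rw [hA, hB]
  inv_mem' := fun {A} hA => by
    have hA : (A : Matrix (Fin n) (Fin n) ℂ)ᴴ * Ipq p q h * A = Ipq p q h := hA
    have h1 : (A : Matrix (Fin n) (Fin n) ℂ) * (A⁻¹ : GL (Fin n) ℂ) = 1 := by
      rw [← Units.val_mul, mul_inv_cancel, Units.val_one]
    have h2 : ((A⁻¹ : GL (Fin n) ℂ) : Matrix (Fin n) (Fin n) ℂ)ᴴ *
        (A : Matrix (Fin n) (Fin n) ℂ)ᴴ = 1 := by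
      rw [← Matrix.conjTranspose_mul, h1, Matrix.conjTranspose_one]
    change ((A⁻¹ : GL (Fin n) ℂ) : Matrix (Fin n) (Fin n) ℂ)ᴴ * Ipq p q h * (A⁻¹ : GL (Fin n) ℂ)
      = Ipq p q h
    calc ((A⁻¹ : GL (Fin n) ℂ) : Matrix (Fin n) (Fin n) ℂ)ᴴ * Ipq p q h * (A⁻¹ : GL (Fin n) ℂ)
        = ((A⁻¹ : GL (Fin n) ℂ) : Matrix (Fin n) (Fin n) ℂ)ᴴ *
            ((A : Matrix (Fin n) (Fin n) ℂ)ᴴ * Ipq p q h * A) * (A⁻¹ : GL (Fin n) ℂ) := by rw [hA]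
      _ = (((A⁻¹ : GL (Fin n) ℂ) : Matrix (Fin n) (Fin n) ℂ)ᴴ *
            (A : Matrix (Fin n) (Fin n) ℂ)ᴴ) * Ipq p q h *
            ((A : Matrix (Fin n) (Fin n) ℂ) * (A⁻¹ : GL (Fin n) ℂ)) := by
          simp only [Matrix.mul_assoc]
      _ = Ipq p q h := by rw [h1, h2, Matrix.one_mul, Matrix.mul_one]

/-- The linear representation of `Γ` on `ℂⁿ` given by `ρ : Γ → GL(n, ℂ)`, acting by
`v ↦ ρ γ *ᵥ v`. -/
def toRepresentation {Γ : Type*} [Group Γ] {n : ℕ} (ρ : RepVar Γ n) :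
    Representation ℂ Γ (Fin n → ℂ) :=
  ((Matrix.toLinAlgEquiv' (R := ℂ) (n := Fin n)).toAlgHom : Matrix (Fin n) (Fin n) ℂ →*
    ((Fin n → ℂ) →ₗ[ℂ] (Fin n → ℂ))).comp ((Units.coeHom (Matrix (Fin n) (Fin n) ℂ)).comp ρ)

/-- `ρ : Γ → GL(n, ℂ)` is semisimple if `ℂⁿ` is a semisimple representation of `Γ`. -/
def IsSemisimple {Γ : Type*} [Group Γ] {n : ℕ} (ρ : RepVar Γ n) : Prop :=
  (toRepresentation ρ).IsSemisimpleRepresentation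

end CharVar

end

/-! A point of the character variety is first lifted to a representation (`chi_surjective`) and then
to a semisimple one (`exists_isSemisimple_chi_eq`). If `Φ₂` fixes the class of a semisimple `ρ`,
then `ρ` and its conjugate dual `ρ'` are semisimple (`IsSemisimple.phi₂Rep`) with equal traces,
hence conjugate (`exists_conjRep_eq_of_chi_eq`). A conjugating matrix is a nondegenerate invariant
sesquilinear form. Some real combination of its two hermitian parts is still nondegenerate
(`exists_invariant_hermitian`), and Sylvester's law turns it into some `I_{p,q}`
(`exists_congruent_Ipq`). Conversely, on `U(p,q)` the matrix `I_{p,q}` conjugates `ρ` to `ρ'`.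

Three classical facts support this. Traces determine semisimple modules in characteristic zero. A
representation of minimal norm in its fibre is semisimple, since passing to a block diagonal part
would lower the norm. Averaging over the unitary group gives a Reynolds operator, so maximal ideals
of the invariant ring extend to proper ideals, and the Nullstellensatz supplies a representation
above each point. -/

noncomputable section

namespace CharVar

/-! ### Traces determine semisimple modules in characteristic zero -/

section BrauerNesbitt

open Polynomial

/-- If `c` fixes a vector `s`, some polynomial in `c` without constant term is idempotent and
fixes `s`. -/
theorem exists_polynomial_isIdempotentElem_aeval {K V : Type*} [Field K] [AddCommGroup V]
    [Module K V] [FiniteDimensional K V] (c : Module.End K V) {s : V} (hs : c s = s) :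
    ∃ q : K[X], q.eval 0 = 0 ∧ IsIdempotentElem (aeval c q) ∧ aeval c q s = s := by
  have hint : IsIntegral K c := IsIntegral.of_finite K c
  -- The factor `X` forces the part `r` prime to `X - 1` to vanish at `0`. With the Bézout relation
  -- `u (X - 1)^k + v r = 1`, the polynomial `v r` gives the projection onto the generalized
  -- eigenspace for `1`.
  have hp : minpoly K c * X ≠ 0 := mul_ne_zero (minpoly.ne_zero hint) X_ne_zero
  obtain ⟨r, hr, hr1⟩ := Polynomial.exists_eq_pow_rootMultiplicity_mul_and_not_dvd _ hp 1
  set k := rootMultiplicity 1 (minpoly K c * X) with hk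
  have hfix : ∀ q : K[X], aeval c q s = q.eval 1 • s := fun q => by
    induction q using Polynomial.induction_on' with
    | add p q hp hq => simp [hp, hq, add_smul]
    | monomial m a =>
      have : ∀ m : ℕ, (c ^ m) s = s := fun m => by
        induction m with
        | zero => simp
        | succ m ih => rw [pow_succ, Module.End.mul_apply, hs, ih]
      simp [aeval_monomial, this]
  have hcop : IsCoprime ((X - C (1 : K)) ^ k) r :=
    IsCoprime.pow_left ((irreducible_X_sub_C (1 : K)).coprime_iff_not_dvd.2 hr1)
  obtain ⟨u, v, huv⟩ := hcop
  have hr0 : r.eval 0 = 0 := by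
    have := congrArg (Polynomial.eval 0) hr
    simp only [eval_mul, eval_X, mul_zero, eval_pow, eval_sub, eval_C, zero_sub] at this
    rcases mul_eq_zero.1 this.symm with h | h
    · exact absurd h (pow_ne_zero _ (neg_ne_zero.2 one_ne_zero))
    · exact h
  have hann : aeval c ((X - C (1 : K)) ^ k * r) = 0 := by
    rw [← hr, map_mul, minpoly.aeval, zero_mul]
  refine ⟨v * r, by simp [hr0], ?_, ?_⟩
  · have h1 : v * r * (v * r) = v * r - u * v * ((X - C (1 : K)) ^ k * r) := by
      linear_combination (v * r) * huv
    rw [IsIdempotentElem, ← map_mul, h1, map_sub, map_mul _ (u * v), hann, mul_zero, sub_zero]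
  · by_cases hs0 : s = 0
    · simp [hs0]
    -- If `k = 0`, then `r` annihilates `c`, so `r(1) s = 0` and `1` would be a root of `r`.
    have hk0 : k ≠ 0 := by
      intro h0
      have h2 := congrArg (fun f : Module.End K V => f s) hann
      simp only [hfix, h0, pow_zero, one_mul, LinearMap.zero_apply] at h2
      refine hr1 (dvd_iff_isRoot.2 ?_)
      simpa [hs0] using h2
    have := congrArg (Polynomial.eval 1) huv
    rw [hfix]
    simp only [eval_add, eval_mul, eval_pow, eval_sub, eval_X, eval_C, sub_self, zero_pow hk0,
      mul_zero, zero_add, eval_one] at this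
    rw [eval_mul, this, one_smul]

variable {K A : Type*} [Field K] [Ring A] [Algebra K A]

/-- If two finite-dimensional modules have the same traces, then an element annihilating the second
one annihilates every simple submodule of the first one. -/
theorem smul_eq_zero_of_trace_eq [CharZero K] {V W : Type*} [AddCommGroup V] [Module K V]
    [Module A V] [IsScalarTower K A V] [FiniteDimensional K V] [AddCommGroup W] [Module K W] [Module A W]
    [IsScalarTower K A W]
    (htr : ∀ a : A, LinearMap.trace K V (Algebra.lsmul K K V a) =
      LinearMap.trace K W (Algebra.lsmul K K W a))
    (S : Submodule A V) [IsSimpleModule A S] {a : A} (ha : ∀ w : W, a • w = 0) (s : S) :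
    a • s = 0 := by
  by_contra hne
  -- By simplicity some `b * a` fixes `s`. A polynomial in `b * a` without constant term is then
  -- idempotent on `V`, fixes `s`, and acts as zero on `W`. Its trace on `V` is therefore zero,
  -- which in characteristic zero kills the idempotent.
  obtain ⟨b, hb⟩ := IsSimpleModule.toSpanSingleton_surjective A hne s
  have hb' : b • a • (s : V) = s := congrArg Subtype.val hb
  have hs : (s : V) ≠ 0 := fun h => hne (by rw [show s = 0 from Subtype.ext h, smul_zero])
  obtain ⟨q, hq0, hidem, hqs⟩ := exists_polynomial_isIdempotentElem_aeval
    (Algebra.lsmul K K V (b * a)) (s := (s : V)) (by simpa [mul_smul] using hb')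
  rw [Polynomial.aeval_algHom_apply] at hidem hqs
  have hW : Algebra.lsmul K K W (aeval (b * a) q) = 0 := by
    have : Algebra.lsmul K K W (b * a) = 0 := by
      ext w
      simp [ha]
    rw [← Polynomial.aeval_algHom_apply, this, ← coeff_zero_eq_aeval_zero']
    simp [coeff_zero_eq_eval_zero, hq0]
  have hV := htr (aeval (b * a) q)
  rw [hW, map_zero] at hV
  have := LinearMap.IsIdempotentElem.eq_zero_of_trace_eq_zero hidem hV
  rw [this] at hqs
  exact hs (by simpa using hqs.symm)

/-- A simple module annihilated by the annihilator of a semisimple module `W` which is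
finite-dimensional over `K` embeds into `W`. -/
theorem exists_injective_of_annihilator_le {S W : Type*} [AddCommGroup S] [Module A S]
    [IsSimpleModule A S] [AddCommGroup W] [Module K W] [Module A W] [IsScalarTower K A W]
    [FiniteDimensional K W] [IsSemisimpleModule A W]
    (h : ∀ a : A, (∀ w : W, a • w = 0) → ∀ s : S, a • s = 0) :
    ∃ f : S →ₗ[A] W, Function.Injective f := by
  have : Nontrivial S := IsSimpleModule.nontrivial A S
  obtain ⟨s, hs⟩ := exists_ne (0 : S)
  let b := Module.finBasis K W
  -- Acting on a `K`-basis embeds `A / Ann(W)` in a power of `W`. Then `S` is a quotient of a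
  -- submodule of that semisimple power, so it splits off, and a nonzero coordinate map on the
  -- simple module `S` is injective.
  let φ : A →ₗ[A] (Fin (Module.finrank K W) → W) :=
    LinearMap.pi fun i => LinearMap.toSpanSingleton A W (b i)
  have hker : LinearMap.ker φ ≤ LinearMap.ker (LinearMap.toSpanSingleton A S s) := by
    intro a ha
    have ha' : ∀ i, a • b i = 0 := fun i => congrFun ha i
    refine h a (fun w => ?_) s
    have : (Algebra.lsmul K K W a) = 0 := b.ext fun i => by simpa using ha' i
    simpa using congrArg (fun f : Module.End K W => f w) this
  let ψ : LinearMap.range φ →ₗ[A] S :=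
    ((LinearMap.ker φ).liftQ _ hker).comp φ.quotKerEquivRange.symm.toLinearMap
  have hψ : Function.Surjective ψ := by
    intro t
    obtain ⟨a, rfl⟩ := IsSimpleModule.toSpanSingleton_surjective A hs t
    exact ⟨φ.quotKerEquivRange (Submodule.Quotient.mk a), by simp [ψ]⟩
  obtain ⟨g, hg⟩ := IsSemisimpleModule.lifting_property ψ hψ LinearMap.id
  obtain ⟨i, hi⟩ : ∃ i, (LinearMap.proj i).comp ((LinearMap.range φ).subtype.comp g) ≠ 0 := by
    by_contra! hall
    have : g s = 0 := Subtype.ext (funext fun i => congrArg (fun f : S →ₗ[A] W => f s) (hall i))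
    have h2 := congrArg (fun f : S →ₗ[A] S => f s) hg
    simp only [LinearMap.comp_apply, this, map_zero, LinearMap.id_apply] at h2
    exact hs h2.symm
  exact ⟨_, LinearMap.injective_of_ne_zero hi⟩

/-- The trace of `a` on a module is the sum of its traces on two complementary submodules. -/
theorem trace_lsmul_eq_add_of_isCompl {V : Type*} [AddCommGroup V] [Module K V] [Module A V]
    [IsScalarTower K A V] [FiniteDimensional K V] {p q : Submodule A V} (h : IsCompl p q) (a : A) :
    LinearMap.trace K V (Algebra.lsmul K K V a) =
      LinearMap.trace K p (Algebra.lsmul K K p a) + LinearMap.trace K q (Algebra.lsmul K K q a) := by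
  have : FiniteDimensional K p := FiniteDimensional.of_injective
    (p.subtype.restrictScalars K) p.injective_subtype
  have : FiniteDimensional K q := FiniteDimensional.of_injective
    (q.subtype.restrictScalars K) q.injective_subtype
  let e := (Submodule.prodEquivOfIsCompl p q h).restrictScalars K
  rw [← LinearMap.trace_prodMap', ← LinearMap.trace_conj' _ e]
  congr 1
  ext v
  obtain ⟨w, rfl⟩ := e.surjective v
  simp [LinearEquiv.conj_apply, e]

/-- Semisimple finite-dimensional modules over a `K`-algebra, `K` a field of characteristic zero,
are isomorphic if they have the same traces. -/
theorem nonempty_linearEquiv_of_trace_eq [CharZero K] {V W : Type*} [AddCommGroup V] [Module K V]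
    [Module A V] [IsScalarTower K A V] [FiniteDimensional K V] [IsSemisimpleModule A V]
    [AddCommGroup W] [Module K W] [Module A W]
    [IsScalarTower K A W] [FiniteDimensional K W] [IsSemisimpleModule A W]
    (htr : ∀ a : A, LinearMap.trace K V (Algebra.lsmul K K V a) =
      LinearMap.trace K W (Algebra.lsmul K K W a)) : Nonempty (V ≃ₗ[A] W) := by
  induction hd : Module.finrank K V using Nat.strong_induction_on generalizing V W with
  | _ d ih =>
  rcases subsingleton_or_nontrivial V with hV | hV
  -- The trace of `1` is the dimension, so `W` vanishes together with `V`.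
  · have h1 := htr 1
    simp only [map_one, LinearMap.trace_one, Module.finrank_zero_of_subsingleton, Nat.cast_zero] at h1
    have : Subsingleton W := Module.finrank_zero_iff.1 (Nat.cast_eq_zero.1 h1.symm)
    exact ⟨0⟩
  · obtain ⟨S, hS⟩ := IsSemisimpleModule.exists_simple_submodule A V
    obtain ⟨f, hf⟩ := exists_injective_of_annihilator_le (K := K) (S := S) (W := W)
      fun a ha s => smul_eq_zero_of_trace_eq htr S ha s
    let e : S ≃ₗ[A] LinearMap.range f := LinearEquiv.ofInjective f hf
    obtain ⟨V', hV'⟩ := exists_isCompl S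
    obtain ⟨W', hW'⟩ := exists_isCompl (LinearMap.range f)
    have : FiniteDimensional K V' := FiniteDimensional.of_injective
      (V'.subtype.restrictScalars K) V'.injective_subtype
    have : FiniteDimensional K W' := FiniteDimensional.of_injective
      (W'.subtype.restrictScalars K) W'.injective_subtype
    have htr' : ∀ a : A, LinearMap.trace K V' (Algebra.lsmul K K V' a) =
        LinearMap.trace K W' (Algebra.lsmul K K W' a) := fun a => by
      -- The common simple summand contributes equally to both traces and cancels.
      have h1 := htr a
      rw [trace_lsmul_eq_add_of_isCompl hV', trace_lsmul_eq_add_of_isCompl hW'] at h1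
      have h2 : LinearMap.trace K S (Algebra.lsmul K K S a) =
          LinearMap.trace K (LinearMap.range f) (Algebra.lsmul K K (LinearMap.range f) a) := by
        rw [← LinearMap.trace_conj' _ (e.restrictScalars K)]
        congr 1
        ext v
        obtain ⟨w, rfl⟩ := e.surjective v
        simp [LinearEquiv.conj_apply]
      rw [h2] at h1
      exact add_left_cancel h1
    have hlt : Module.finrank K V' < d := by
      rw [← hd]
      refine Submodule.finrank_lt (s := V'.restrictScalars K) fun htop => ?_
      have hV'top : V' = ⊤ := by
        rw [eq_top_iff]
        intro x _
        have : x ∈ V'.restrictScalars K := htop ▸ Submodule.mem_top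
        exact this
      have hbot : S = ⊥ := by
        have := hV'.inf_eq_bot
        rwa [hV'top, inf_top_eq] at this
      exact (isSimpleModule_iff_isAtom.1 hS).1 hbot
    obtain ⟨e'⟩ := ih _ hlt htr' rfl
    exact ⟨(Submodule.prodEquivOfIsCompl S V' hV').symm.trans
      ((e.prodCongr e').trans (Submodule.prodEquivOfIsCompl _ W' hW'))⟩

end BrauerNesbitt

/-! ### Characters, semisimplicity and the conjugate dual -/

section Basics

variable {Γ : Type*} [Group Γ] {n : ℕ}

theorem coe_conjRep (g : GL (Fin n) ℂ) (ρ : RepVar Γ n) (γ : Γ) :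
    (conjRep g ρ γ : Matrix (Fin n) (Fin n) ℂ) =
      (g : Matrix (Fin n) (Fin n) ℂ) * (ρ γ : Matrix (Fin n) (Fin n) ℂ) *
        ((g⁻¹ : GL (Fin n) ℂ) : Matrix (Fin n) (Fin n) ℂ) := rfl

theorem conjRep_mul (g h : GL (Fin n) ℂ) (ρ : RepVar Γ n) :
    conjRep (g * h) ρ = conjRep g (conjRep h ρ) := by
  ext1 γ
  simp [conjRep, mul_assoc]

theorem chi_eq_chi_iff {ρ σ : RepVar Γ n} :
    chi ρ = chi σ ↔ ∀ f ∈ invariantFunctions Γ n, f ρ = f σ :=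
  ⟨fun h f hf => DFunLike.congr_fun h ⟨f, hf⟩, fun h => AlgHom.ext fun f => h f f.2⟩

theorem chi_conjRep (g : GL (Fin n) ℂ) (ρ : RepVar Γ n) : chi (conjRep g ρ) = chi ρ :=
  chi_eq_chi_iff.2 fun _ hf => hf.2 g ρ

theorem entry_mem_regularFunctions (γ : Γ) (i j : Fin n) :
    (fun ρ : RepVar Γ n => (ρ γ : Matrix (Fin n) (Fin n) ℂ) i j) ∈ regularFunctions Γ n :=
  Algebra.subset_adjoin ⟨γ, i, j, rfl⟩

theorem trace_mem_invariantFunctions (γ : Γ) :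
    (fun ρ : RepVar Γ n => (ρ γ : Matrix (Fin n) (Fin n) ℂ).trace) ∈ invariantFunctions Γ n := by
  refine ⟨?_, fun g ρ => ?_⟩
  · have : (fun ρ : RepVar Γ n => (ρ γ : Matrix (Fin n) (Fin n) ℂ).trace) =
        ∑ i, fun ρ : RepVar Γ n => (ρ γ : Matrix (Fin n) (Fin n) ℂ) i i := by
      ext ρ
      simp [Matrix.trace]
    rw [this]
    exact sum_mem fun i _ => entry_mem_regularFunctions γ i i
  · simp only [coe_conjRep]
    rw [Matrix.trace_mul_comm, ← mul_assoc, ← Units.val_mul]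
    simp

/-- A representation is semisimple if and only if every invariant subspace is the image of an
idempotent commuting with the representation. -/
theorem isSemisimple_iff {ρ : RepVar Γ n} :
    IsSemisimple ρ ↔ ∀ U : Submodule ℂ (Fin n → ℂ),
      (∀ γ, ∀ v ∈ U, (ρ γ : Matrix (Fin n) (Fin n) ℂ) *ᵥ v ∈ U) →
      ∃ e : Matrix (Fin n) (Fin n) ℂ, (∀ γ, Commute e (ρ γ : Matrix (Fin n) (Fin n) ℂ)) ∧
        (∀ v, e *ᵥ v ∈ U) ∧ ∀ v ∈ U, e *ᵥ v = v := by
  constructor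
  · intro h U hU
    have hc : ComplementedLattice (Subrepresentation (toRepresentation ρ)) := h
    obtain ⟨C, hC⟩ := exists_isCompl (⟨U, fun γ v hv => hU γ v hv⟩ :
      Subrepresentation (toRepresentation ρ))
    have hUC : IsCompl U C.toSubmodule := by
      constructor
      · rw [disjoint_iff]
        have := congrArg Subrepresentation.toSubmodule hC.inf_eq_bot
        rwa [Subrepresentation.toSubmodule_inf] at this
      · rw [codisjoint_iff]
        have := congrArg Subrepresentation.toSubmodule hC.sup_eq_top
        rwa [Subrepresentation.toSubmodule_sup] at this
    refine ⟨LinearMap.toMatrix' (Submodule.projection U C.toSubmodule hUC), fun γ => ?_,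
      fun v => ?_, fun v hv => ?_⟩
    · refine Matrix.toLin'.injective (LinearMap.ext fun v => ?_)
      obtain ⟨x, hx, y, hy, rfl⟩ : ∃ x ∈ U, ∃ y ∈ C.toSubmodule, x + y = v := by
        rw [← Submodule.mem_sup, hUC.sup_eq_top]
        trivial
      have h1 := hU γ x hx
      have h2 : (ρ γ : Matrix (Fin n) (Fin n) ℂ) *ᵥ y ∈ C.toSubmodule :=
        C.apply_mem_toSubmodule γ hy
      simp only [Matrix.toLin'_mul, Matrix.toLin'_toMatrix', LinearMap.comp_apply,
        Matrix.toLin'_apply, map_add]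
      rw [Submodule.projection_apply_of_mem_left hUC h1,
        Submodule.projection_apply_of_mem_right hUC h2,
        Submodule.projection_apply_of_mem_left hUC hx,
        Submodule.projection_apply_of_mem_right hUC hy]
      simp
    · rw [LinearMap.toMatrix'_mulVec]
      exact Submodule.projection_apply_mem hUC v
    · rw [LinearMap.toMatrix'_mulVec]
      exact Submodule.projection_apply_of_mem_left hUC hv
  · intro h
    refine ⟨fun U => ?_⟩
    obtain ⟨e, he, heU, heid⟩ := h U.toSubmodule fun γ v hv => U.apply_mem_toSubmodule γ hv
    refine ⟨⟨LinearMap.ker (Matrix.toLin' e), fun γ v hv => ?_⟩, ?_, ?_⟩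
    · have hv' : e *ᵥ v = 0 := hv
      change e *ᵥ ((ρ γ : Matrix (Fin n) (Fin n) ℂ) *ᵥ v) = 0
      rw [Matrix.mulVec_mulVec, (he γ).eq, ← Matrix.mulVec_mulVec, hv', Matrix.mulVec_zero]
    · rw [disjoint_iff]
      refine Subrepresentation.toSubmodule_injective ?_
      rw [Subrepresentation.toSubmodule_inf]
      refine (Submodule.eq_bot_iff _).2 fun v hv => ?_
      have h1 : e *ᵥ v = 0 := hv.2
      rw [← heid v hv.1, h1]
    · rw [codisjoint_iff]
      refine Subrepresentation.toSubmodule_injective ?_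
      rw [Subrepresentation.toSubmodule_sup]
      refine Submodule.eq_top_iff'.2 fun v => Submodule.mem_sup.2
        ⟨e *ᵥ v, heU v, v - e *ᵥ v, ?_, by simp⟩
      change e *ᵥ (v - e *ᵥ v) = 0
      rw [Matrix.mulVec_sub, heid _ (heU v), sub_self]

/-- The orthogonal projection onto a subspace of `ℂⁿ`, as a matrix. -/
theorem exists_orthogonalProjection (U : Submodule ℂ (Fin n → ℂ)) :
    ∃ p : Matrix (Fin n) (Fin n) ℂ, p * p = p ∧ pᴴ = p ∧
      (∀ v, p *ᵥ v ∈ U) ∧ ∀ v ∈ U, p *ᵥ v = v := by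
  let E := EuclideanSpace ℂ (Fin n)
  let ℓ : E ≃ₗ[ℂ] (Fin n → ℂ) := WithLp.linearEquiv 2 ℂ (Fin n → ℂ)
  let U' : Submodule ℂ E := U.comap ℓ.toLinearMap
  let P : E →L[ℂ] E := U'.starProjection
  let Φ := Matrix.toEuclideanCLM (𝕜 := ℂ) (n := Fin n)
  have hΦ : ∀ v, (Φ.symm P) *ᵥ v = ℓ (P (ℓ.symm v)) := fun v => by
    have : P (ℓ.symm v) = Φ (Φ.symm P) (ℓ.symm v) := by rw [StarAlgEquiv.apply_symm_apply]
    rw [this]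
    rfl
  refine ⟨Φ.symm P, ?_, ?_, fun v => ?_, fun v hv => ?_⟩
  · rw [← map_mul, U'.isIdempotentElem_starProjection]
  · refine (Φ.symm.map_star' P).symm.trans ?_
    rw [(isStarProjection_starProjection (U := U')).isSelfAdjoint.star_eq]
    rfl
  · rw [hΦ]
    exact U'.starProjection_apply_mem (ℓ.symm v)
  · rw [hΦ, Submodule.starProjection_eq_self_iff.2]
    · simp
    · simpa [U'] using hv

/-- Adjunction exchanges `ρ` and its conjugate dual up to `γ ↦ γ⁻¹`, so invariance and commutation
relations dualize without matrix inverses. -/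
theorem conjTranspose_coe_phi₂Rep (ρ : RepVar Γ n) (γ : Γ) :
    (phi₂Rep ρ γ : Matrix (Fin n) (Fin n) ℂ)ᴴ = (ρ γ⁻¹ : Matrix (Fin n) (Fin n) ℂ) := by
  have : phi₂Rep ρ γ = star (ρ γ⁻¹) := by simp [phi₂Rep, phi₂GL]
  rw [this]
  exact conjTranspose_conjTranspose _

/-- If `ρ` is semisimple, then so is `γ ↦ (ρ(γ)ᴴ)⁻¹`. -/
theorem IsSemisimple.phi₂Rep {ρ : RepVar Γ n} (h : IsSemisimple ρ) : IsSemisimple (phi₂Rep ρ) := by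
  rw [isSemisimple_iff] at h ⊢
  intro U hU
  -- The orthogonal complement `ker p` of `U` is invariant under `ρ`. If `e` is a projection onto it
  -- commuting with `ρ`, then `1 - eᴴ` is the required projection onto `U`.
  obtain ⟨p, hp, hpH, hpU, hpid⟩ := exists_orthogonalProjection U
  have h1 : ∀ γ, p * (CharVar.phi₂Rep ρ γ : Matrix (Fin n) (Fin n) ℂ) * p =
      (CharVar.phi₂Rep ρ γ : Matrix (Fin n) (Fin n) ℂ) * p := fun γ => by
    refine Matrix.toLin'.injective (LinearMap.ext fun v => ?_)
    simp only [Matrix.toLin'_apply, ← Matrix.mulVec_mulVec]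
    exact hpid _ (hU γ _ (hpU v))
  have h2 : ∀ γ, p * (ρ γ : Matrix (Fin n) (Fin n) ℂ) * p =
      p * (ρ γ : Matrix (Fin n) (Fin n) ℂ) := fun γ => by
    have := congrArg conjTranspose (h1 γ⁻¹)
    rwa [conjTranspose_mul, conjTranspose_mul, conjTranspose_mul, conjTranspose_coe_phi₂Rep, hpH,
      inv_inv, ← mul_assoc] at this
  obtain ⟨e, he, hek, heid⟩ := h (LinearMap.ker (Matrix.toLin' p)) fun γ v hv => by
    have hv' : p *ᵥ v = 0 := hv
    change p *ᵥ ((ρ γ : Matrix (Fin n) (Fin n) ℂ) *ᵥ v) = 0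
    rw [Matrix.mulVec_mulVec, ← h2, ← Matrix.mulVec_mulVec, hv', Matrix.mulVec_zero]
  have hpe : p * e = 0 := by
    refine Matrix.toLin'.injective (LinearMap.ext fun v => ?_)
    simp only [Matrix.toLin'_apply, ← Matrix.mulVec_mulVec, map_zero, LinearMap.zero_apply]
    exact hek v
  have hep : e * (1 - p) = 1 - p := by
    refine Matrix.toLin'.injective (LinearMap.ext fun v => ?_)
    simp only [Matrix.toLin'_apply, ← Matrix.mulVec_mulVec]
    refine heid _ ?_
    change p *ᵥ ((1 - p) *ᵥ v) = 0
    rw [Matrix.mulVec_mulVec, mul_sub, hp, mul_one, sub_self, Matrix.zero_mulVec]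
  have hpe' : eᴴ * p = 0 := by
    have := congrArg conjTranspose hpe
    rwa [conjTranspose_mul, hpH, conjTranspose_zero] at this
  have hep' : p * (1 - eᴴ) = 1 - eᴴ := by
    have := congrArg conjTranspose hep
    simp only [conjTranspose_mul, conjTranspose_sub, conjTranspose_one, hpH] at this
    rw [sub_mul, one_mul, sub_eq_iff_eq_add] at this
    rw [mul_sub, mul_one, sub_eq_sub_iff_add_eq_add]
    conv_lhs => rw [this]
    abel
  refine ⟨1 - eᴴ, fun γ => ?_, fun v => ?_, fun v hv => ?_⟩
  · have := congrArg conjTranspose (he γ⁻¹).eq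
    rw [conjTranspose_mul, conjTranspose_mul, ← conjTranspose_coe_phi₂Rep,
      conjTranspose_conjTranspose] at this
    exact (Commute.one_left _).sub_left this.symm
  · rw [← hep', ← Matrix.mulVec_mulVec]
    exact hpU _
  · rw [← hpid v hv, Matrix.mulVec_mulVec, sub_mul, hpe', one_mul, sub_zero]

/-- Semisimple representations with the same image in the character variety are conjugate. -/
theorem exists_conjRep_eq_of_chi_eq {ρ σ : RepVar Γ n} (hρ : IsSemisimple ρ) (hσ : IsSemisimple σ)
    (h : chi ρ = chi σ) : ∃ P : GL (Fin n) ℂ, conjRep P ρ = σ := by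
  have hρ' := (Representation.isSemisimpleRepresentation_iff_isSemisimpleModule_asModule _).1 hρ
  have hσ' := (Representation.isSemisimpleRepresentation_iff_isSemisimpleModule_asModule _).1 hσ
  have htr : ∀ a : MonoidAlgebra ℂ Γ,
      LinearMap.trace ℂ _ (Algebra.lsmul ℂ ℂ (toRepresentation ρ).asModule a) =
      LinearMap.trace ℂ _ (Algebra.lsmul ℂ ℂ (toRepresentation σ).asModule a) := by
    have key : ∀ (τ : RepVar Γ n) (a : MonoidAlgebra ℂ Γ),
        LinearMap.trace ℂ _ (Algebra.lsmul ℂ ℂ (toRepresentation τ).asModule a) =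
        LinearMap.trace ℂ _ ((toRepresentation τ).asAlgebraHom a) := fun τ a => rfl
    -- By linearity only group elements matter, and their traces are invariant functions.
    intro a
    rw [key, key]
    induction a using MonoidAlgebra.induction_on with
    | of γ =>
      have := chi_eq_chi_iff.1 h _ (trace_mem_invariantFunctions γ)
      rw [Representation.asAlgebraHom_of, Representation.asAlgebraHom_of]
      change LinearMap.trace ℂ _ (Matrix.toLin' (ρ γ : Matrix (Fin n) (Fin n) ℂ)) =
        LinearMap.trace ℂ _ (Matrix.toLin' (σ γ : Matrix (Fin n) (Fin n) ℂ))
      rwa [Matrix.trace_toLin'_eq, Matrix.trace_toLin'_eq]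
    | add a b ha hb => rw [map_add, map_add, map_add, map_add, ha, hb]
    | smul r a ha => rw [map_smul, map_smul, map_smul, map_smul, ha]
  obtain ⟨e⟩ := nonempty_linearEquiv_of_trace_eq htr
  let E : (Fin n → ℂ) ≃ₗ[ℂ] (Fin n → ℂ) := (toRepresentation ρ).asModuleEquiv.symm.trans
    ((e.restrictScalars ℂ).trans (toRepresentation σ).asModuleEquiv)
  have hE : ∀ γ v, E ((ρ γ : Matrix (Fin n) (Fin n) ℂ) *ᵥ v) =
      (σ γ : Matrix (Fin n) (Fin n) ℂ) *ᵥ E v := fun γ v => by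
    have h1 := (toRepresentation ρ).asModuleEquiv_symm_map_rho γ v
    have h2 := e.map_smul (MonoidAlgebra.of ℂ Γ γ) ((toRepresentation ρ).asModuleEquiv.symm v)
    rw [← h1] at h2
    have h3 := congrArg (toRepresentation σ).asModuleEquiv h2
    rw [Representation.asModuleEquiv_map_smul, Representation.asAlgebraHom_of] at h3
    exact h3
  let P : GL (Fin n) ℂ := ⟨LinearMap.toMatrix' E.toLinearMap, LinearMap.toMatrix' E.symm.toLinearMap,
    by rw [← LinearMap.toMatrix'_comp]; simp, by rw [← LinearMap.toMatrix'_comp]; simp⟩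
  refine ⟨P, MonoidHom.ext fun γ => ?_⟩
  have : P * ρ γ = σ γ * P := by
    refine Units.ext (Matrix.toLin'.injective (LinearMap.ext fun v => ?_))
    simpa [P] using hE γ v
  simp [conjRep, this]

end Basics

/-! ### Degeneration to block diagonal form and vectors of minimal norm -/

section KempfNess

open Filter Topology

variable {Γ : Type*} [Group Γ] {n : ℕ}

/-- Regular functions are continuous for pointwise convergence of representations. -/
theorem tendsto_of_mem_regularFunctions {f : RepVar Γ n → ℂ} (hf : f ∈ regularFunctions Γ n)
    {ι : Type*} {l : Filter ι} {σ : ι → RepVar Γ n} {τ : RepVar Γ n}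
    (h : ∀ γ, Tendsto (fun t => (σ t γ : Matrix (Fin n) (Fin n) ℂ)) l
      (𝓝 (τ γ : Matrix (Fin n) (Fin n) ℂ))) :
    Tendsto (fun t => f (σ t)) l (𝓝 (f τ)) := by
  unfold regularFunctions at hf
  induction hf using Algebra.adjoin_induction with
  | mem x hx =>
    obtain ⟨γ, i, j, rfl⟩ := hx
    exact ((continuous_id.matrix_elem i j).tendsto _).comp (h γ)
  | algebraMap r => exact tendsto_const_nhds
  | add x y _ _ hx hy => exact hx.add hy
  | mul x y _ _ hx hy => exact hx.mul hy

/-- For `p + q = 1` the last two hypotheses say that `x` and `y` are block upper triangular, and the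
diagonal blocks of such elements multiply separately. -/
theorem blockDiagonal_mul {R : Type*} [Ring R] {p q x y : R} (hp : p * p = p) (hq : q * q = q)
    (hpq : p * q = 0) (hqp : q * p = 0) (hx : q * x * q = q * x) (hy : p * y * p = y * p) :
    (p * x * p + q * x * q) * (p * y * p + q * y * q) = p * (x * y) * p + q * (x * y) * q := by
  have h1 : p * x * p * (p * y * p) = p * (x * y) * p := by
    calc p * x * p * (p * y * p) = p * x * ((p * p) * y * p) := by simp only [mul_assoc]
      _ = p * (x * y) * p := by rw [hp, hy]; simp only [mul_assoc]
  have h2 : p * x * p * (q * y * q) = 0 := by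
    calc p * x * p * (q * y * q) = p * x * (p * q) * (y * q) := by simp only [mul_assoc]
      _ = 0 := by rw [hpq]; simp
  have h3 : q * x * q * (p * y * p) = 0 := by
    calc q * x * q * (p * y * p) = q * x * (q * p) * (y * p) := by simp only [mul_assoc]
      _ = 0 := by rw [hqp]; simp
  have h4 : q * x * q * (q * y * q) = q * (x * y) * q := by
    calc q * x * q * (q * y * q) = q * x * (q * q) * (y * q) := by simp only [mul_assoc]
      _ = q * (x * y) * q := by rw [hq, hx]; simp only [mul_assoc]
  rw [add_mul, mul_add, mul_add, h1, h2, h3, h4, add_zero, zero_add]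

/-- If the image of the idempotent `p` is invariant under `σ`, then the block diagonal part of `σ`
with respect to `p` is a representation with the same image in the character variety. -/
theorem exists_blockDiagonal_chi_eq (σ : RepVar Γ n) {p : Matrix (Fin n) (Fin n) ℂ}
    (hp : p * p = p) (hσ : ∀ γ, p * (σ γ : Matrix (Fin n) (Fin n) ℂ) * p =
      (σ γ : Matrix (Fin n) (Fin n) ℂ) * p) :
    ∃ τ : RepVar Γ n, chi τ = chi σ ∧ ∀ γ, (τ γ : Matrix (Fin n) (Fin n) ℂ) =
      p * (σ γ : Matrix (Fin n) (Fin n) ℂ) * p +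
        (1 - p) * (σ γ : Matrix (Fin n) (Fin n) ℂ) * (1 - p) := by
  obtain ⟨q, hq⟩ : ∃ q, q = 1 - p := ⟨_, rfl⟩
  rw [← hq]
  have hqq : q * q = q := by rw [hq]; simp [mul_sub, sub_mul, hp]
  have hpq : p * q = 0 := by rw [hq]; simp [mul_sub, hp]
  have hqp : q * p = 0 := by rw [hq]; simp [sub_mul, hp]
  have hpaddq : p + q = 1 := by rw [hq]; abel
  have hlow : ∀ γ, q * (σ γ : Matrix (Fin n) (Fin n) ℂ) * p = 0 := fun γ => by
    rw [mul_assoc, ← hσ, mul_assoc, ← mul_assoc, hqp, zero_mul]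
  have hqσ : ∀ γ, q * (σ γ : Matrix (Fin n) (Fin n) ℂ) * q =
      q * (σ γ : Matrix (Fin n) (Fin n) ℂ) := fun γ => by
    conv_rhs => rw [← mul_one (q * (σ γ : Matrix (Fin n) (Fin n) ℂ)), ← hpaddq, mul_add, hlow,
      zero_add]
  let m : Γ →* Matrix (Fin n) (Fin n) ℂ :=
    { toFun := fun γ => p * (σ γ : Matrix (Fin n) (Fin n) ℂ) * p +
        q * (σ γ : Matrix (Fin n) (Fin n) ℂ) * q
      map_one' := by simp [hp, hqq, hpaddq]
      map_mul' := fun γ δ => by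
        rw [blockDiagonal_mul hp hqq hpq hqp (hqσ γ) (hσ δ), map_mul, Units.val_mul] }
  let τ : RepVar Γ n := m.toHomUnits
  have hτ : ∀ γ, (τ γ : Matrix (Fin n) (Fin n) ℂ) = p * (σ γ : Matrix (Fin n) (Fin n) ℂ) * p +
      q * (σ γ : Matrix (Fin n) (Fin n) ℂ) * q := fun γ => rfl
  refine ⟨τ, ?_, hτ⟩
  -- Conjugation by this one-parameter group fixes the diagonal blocks and scales the upper right
  -- block by `s`. As `s → 0` the orbit converges to `τ`, so invariant functions agree at `σ` and
  -- `τ`.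
  let g : ℂˣ → GL (Fin n) ℂ := fun s =>
    ⟨p + (s⁻¹ : ℂˣ).val • q, p + s.val • q,
      by simp [mul_add, add_mul, hp, hpq, hqp, hqq, hpaddq, smul_smul],
      by simp [mul_add, add_mul, hp, hpq, hqp, hqq, hpaddq, smul_smul]⟩
  have hg : ∀ s γ, (conjRep (g s) σ γ : Matrix (Fin n) (Fin n) ℂ) =
      (τ γ : Matrix (Fin n) (Fin n) ℂ) + s.val • (p * (σ γ : Matrix (Fin n) (Fin n) ℂ) * q) := by
    intro s γ
    have : (conjRep (g s) σ γ : Matrix (Fin n) (Fin n) ℂ) = (p + (s⁻¹ : ℂˣ).val • q) *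
      (σ γ : Matrix (Fin n) (Fin n) ℂ) * (p + s.val • q) := rfl
    rw [this, hτ]
    simp only [add_mul, mul_add, smul_mul_assoc, mul_smul_comm, hlow, smul_add, smul_smul, smul_zero,
      add_zero, Units.mul_inv, one_smul]
    abel
  let u : ℕ → ℂˣ := fun k => Units.mk0 ((k + 1 : ℂ)⁻¹) (inv_ne_zero (Nat.cast_add_one_ne_zero k))
  have hu : Tendsto (fun k => (u k).val) atTop (𝓝 0) := by
    have := tendsto_one_div_add_atTop_nhds_zero_nat (𝕜 := ℂ)
    simpa [u, one_div] using this
  refine chi_eq_chi_iff.2 fun f hf => ?_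
  have hlim : Tendsto (fun k => f (conjRep (g (u k)) σ)) atTop (𝓝 (f τ)) := by
    refine tendsto_of_mem_regularFunctions hf.1 fun γ => ?_
    simp only [hg]
    have := (hu.smul_const (p * (σ γ : Matrix (Fin n) (Fin n) ℂ) * q)).const_add
      (τ γ : Matrix (Fin n) (Fin n) ℂ)
    simpa using this
  simp only [hf.2] at hlim
  exact tendsto_nhds_unique hlim tendsto_const_nhds |>.symm ▸ rfl

/-- The square of the Frobenius norm. -/
def frobSq (x : Matrix (Fin n) (Fin n) ℂ) : ℝ := (xᴴ * x).trace.re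

theorem frobSq_eq_sum (x : Matrix (Fin n) (Fin n) ℂ) : frobSq x = ∑ j, ∑ i, ‖x i j‖ ^ 2 := by
  simp only [frobSq, Matrix.trace, Matrix.diag, Matrix.mul_apply, Complex.re_sum,
    conjTranspose_apply]
  refine Finset.sum_congr rfl fun j _ => Finset.sum_congr rfl fun i _ => ?_
  rw [← Complex.normSq_eq_norm_sq, ← Complex.ofReal_re (Complex.normSq _),
    Complex.normSq_eq_conj_mul_self]
  rfl

theorem frobSq_nonneg (x : Matrix (Fin n) (Fin n) ℂ) : 0 ≤ frobSq x := by
  rw [frobSq_eq_sum]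
  positivity

theorem norm_entry_sq_le_frobSq (x : Matrix (Fin n) (Fin n) ℂ) (i j : Fin n) :
    ‖x i j‖ ^ 2 ≤ frobSq x := by
  rw [frobSq_eq_sum]
  refine le_trans ?_ (Finset.single_le_sum (f := fun j => ∑ i, ‖x i j‖ ^ 2)
    (fun _ _ => by positivity) (Finset.mem_univ j))
  exact Finset.single_le_sum (f := fun i => ‖x i j‖ ^ 2) (fun _ _ => by positivity)
    (Finset.mem_univ i)

theorem eq_zero_of_frobSq_eq_zero {x : Matrix (Fin n) (Fin n) ℂ} (h : frobSq x = 0) : x = 0 := by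
  ext i j
  have := norm_entry_sq_le_frobSq x i j
  rw [h] at this
  simpa using this

theorem continuous_frobSq : Continuous (frobSq : Matrix (Fin n) (Fin n) ℂ → ℝ) := by
  unfold frobSq
  fun_prop

/-- Pythagoras for the upper triangular part with respect to an orthogonal projection. -/
theorem frobSq_eq_add {p x : Matrix (Fin n) (Fin n) ℂ} (hp : p * p = p) (hpH : pᴴ = p)
    (hx : p * x * p = x * p) :
    frobSq x = frobSq (p * x * p + (1 - p) * x * (1 - p)) + frobSq (p * x * (1 - p)) := by
  obtain ⟨q, hq⟩ : ∃ q, q = 1 - p := ⟨_, rfl⟩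
  rw [← hq]
  have hpq : p * q = 0 := by rw [hq]; simp [mul_sub, hp]
  have hqp : q * p = 0 := by rw [hq]; simp [sub_mul, hp]
  have hqH : qᴴ = q := by rw [hq]; simp [hpH]
  have hpaddq : p + q = 1 := by rw [hq]; abel
  have hlow : q * x * p = 0 := by rw [mul_assoc, ← hx, mul_assoc, ← mul_assoc, hqp, zero_mul]
  set d := p * x * p + q * x * q with hd
  set y := p * x * q with hy
  have hsum : x = d + y := by
    calc x = (p + q) * x * (p + q) := by rw [hpaddq]; simp
      _ = d + y := by
        simp only [add_mul, mul_add, hlow, hd, hy]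
        abel
  have hdy : (dᴴ * y).trace = 0 := by
    have h1 : dᴴ * y = (p * xᴴ * p * x) * q := by
      simp only [hd, hy, conjTranspose_add, conjTranspose_mul, hpH, hqH, add_mul]
      have e1 : p * (xᴴ * p) * (p * x * q) = p * xᴴ * (p * p) * x * q := by simp only [mul_assoc]
      have e2 : q * (xᴴ * q) * (p * x * q) = q * xᴴ * (q * p) * x * q := by simp only [mul_assoc]
      rw [e1, e2, hp, hqp]
      simp
    rw [h1, Matrix.trace_mul_comm]
    have : q * (p * xᴴ * p * x) = (q * p) * (xᴴ * p * x) := by simp only [mul_assoc]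
    rw [this, hqp, zero_mul, Matrix.trace_zero]
  have hyd : (yᴴ * d).trace = 0 := by
    have : yᴴ * d = (dᴴ * y)ᴴ := by simp
    rw [this, Matrix.trace_conjTranspose, hdy, star_zero]
  conv_lhs => rw [hsum]
  simp only [frobSq, conjTranspose_add, add_mul, mul_add, Matrix.trace_add, hdy, hyd]
  simp

/-- A bound on the generators bounds every value of the representation. -/
theorem exists_bound_entry {S : Finset Γ} (hS : Submonoid.closure (S : Set Γ) = ⊤) (c : ℝ) (γ : Γ) :
    ∃ C : ℝ, ∀ σ : RepVar Γ n, ∑ δ ∈ S, frobSq (σ δ : Matrix (Fin n) (Fin n) ℂ) ≤ c →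
      ∀ i j, ‖(σ γ : Matrix (Fin n) (Fin n) ℂ) i j‖ ≤ C := by
  have hγ : γ ∈ Submonoid.closure (S : Set Γ) := hS ▸ Submonoid.mem_top γ
  induction hγ using Submonoid.closure_induction with
  | mem δ hδ =>
    -- This uses `t ≤ t² + 1`. Since `S` generates `Γ` as a monoid, inverses need no separate bound.
    refine ⟨c + 1, fun σ hσ i j => ?_⟩
    have h1 := norm_entry_sq_le_frobSq (σ δ : Matrix (Fin n) (Fin n) ℂ) i j
    have h2 := Finset.single_le_sum (f := fun δ => frobSq (σ δ : Matrix (Fin n) (Fin n) ℂ))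
      (fun _ _ => frobSq_nonneg _) hδ
    nlinarith [sq_nonneg (‖(σ δ : Matrix (Fin n) (Fin n) ℂ) i j‖ - 1)]
  | one =>
    refine ⟨1, fun σ _ i j => ?_⟩
    rw [map_one, Units.val_one, Matrix.one_apply]
    split_ifs <;> simp
  | mul a b _ _ ha hb =>
    obtain ⟨C, hC⟩ := ha
    obtain ⟨D, hD⟩ := hb
    refine ⟨∑ _k : Fin n, C * D, fun σ hσ i j => ?_⟩
    rw [map_mul, Units.val_mul, Matrix.mul_apply]
    refine (norm_sum_le _ _).trans (Finset.sum_le_sum fun k _ => ?_)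
    rw [norm_mul]
    exact mul_le_mul (hC σ hσ i k) (hD σ hσ k j) (norm_nonneg _)
      ((norm_nonneg _).trans (hC σ hσ i k))

/-- In every fibre of `chi`, the sum of the squared norms of the generators attains its minimum. -/
theorem exists_minimal_chi_eq {S : Finset Γ} (hS : Submonoid.closure (S : Set Γ) = ⊤)
    (ρ : RepVar Γ n) :
    ∃ σ : RepVar Γ n, chi σ = chi ρ ∧ ∀ τ : RepVar Γ n, chi τ = chi ρ →
      ∑ δ ∈ S, frobSq (σ δ : Matrix (Fin n) (Fin n) ℂ) ≤
        ∑ δ ∈ S, frobSq (τ δ : Matrix (Fin n) (Fin n) ℂ) := by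
  let j : RepVar Γ n → (Γ → Matrix (Fin n) (Fin n) ℂ) := fun σ γ => σ γ
  let _ : TopologicalSpace (RepVar Γ n) := TopologicalSpace.induced j inferInstance
  have hind : IsInducing j := ⟨rfl⟩
  have hcont : ∀ γ, Continuous fun σ : RepVar Γ n => (σ γ : Matrix (Fin n) (Fin n) ℂ) := fun γ =>
    (continuous_apply γ).comp hind.continuous
  have hemb : IsClosedEmbedding j := by
    refine ⟨⟨hind, fun σ τ h => MonoidHom.ext fun γ => Units.ext (congrFun h γ)⟩, ?_⟩
    -- Invertibility is not an extra condition: a monoid homomorphism from a group takes values in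
    -- units. The image is thus cut out by closed equations alone.
    have : Set.range j = {m | m 1 = 1} ∩ ⋂ (γ : Γ) (δ : Γ), {m | m (γ * δ) = m γ * m δ} := by
      ext m
      constructor
      · rintro ⟨σ, rfl⟩
        refine ⟨by simp [j], ?_⟩
        simp [j]
      · rintro ⟨h1, h2⟩
        simp only [Set.mem_iInter, Set.mem_ofPred_eq] at h1 h2
        exact ⟨MonoidHom.toHomUnits ⟨⟨m, h1⟩, h2⟩, rfl⟩
    rw [this]
    refine IsClosed.inter (isClosed_eq (continuous_apply _) continuous_const)
      (isClosed_iInter fun γ => isClosed_iInter fun δ => isClosed_eq (continuous_apply _) ?_)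
    exact (continuous_apply γ).mul (continuous_apply δ)
  set N : RepVar Γ n → ℝ := fun σ => ∑ δ ∈ S, frobSq (σ δ : Matrix (Fin n) (Fin n) ℂ) with hN
  have hNc : Continuous N := continuous_finsetSum _ fun δ _ => continuous_frobSq.comp (hcont δ)
  have hfib : IsClosed {σ : RepVar Γ n | chi σ = chi ρ} := by
    have : {σ : RepVar Γ n | chi σ = chi ρ} =
        ⋂ f ∈ invariantFunctions Γ n, {σ : RepVar Γ n | f σ = f ρ} := by
      ext σ
      simp [chi_eq_chi_iff]
    rw [this]
    refine isClosed_biInter fun f hf => isClosed_eq ?_ continuous_const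
    refine continuous_iff_continuousAt.2 fun σ => ?_
    exact tendsto_of_mem_regularFunctions hf.1 fun γ => (hcont γ).tendsto σ
  -- Entrywise bounds at every `γ` place the sublevel set in a product of closed balls, compact by
  -- Tychonoff.
  choose C hC using exists_bound_entry (n := n) hS (N ρ)
  have hbox : IsCompact (Set.univ.pi fun γ => Set.univ.pi fun _ => Set.univ.pi fun _ =>
      Metric.closedBall (0 : ℂ) (C γ) : Set (Γ → Fin n → Fin n → ℂ)) :=
    isCompact_univ_pi fun γ => isCompact_univ_pi fun _ => isCompact_univ_pi fun _ =>
      isCompact_closedBall _ _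
  have hK : IsCompact ({σ : RepVar Γ n | chi σ = chi ρ} ∩ {σ | N σ ≤ N ρ}) := by
    refine (hemb.isCompact_preimage hbox).of_isClosed_subset
      (hfib.inter (isClosed_le hNc continuous_const)) ?_
    rintro σ ⟨-, hσ⟩ γ - i - k -
    simpa using hC γ σ hσ i k
  obtain ⟨σ, hσ, hmin⟩ := hK.exists_isMinOn ⟨ρ, rfl, le_refl (N ρ)⟩ hNc.continuousOn
  refine ⟨σ, hσ.1, fun τ hτ => ?_⟩
  rcases le_total (N τ) (N ρ) with h | h
  · exact hmin ⟨hτ, h⟩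
  · exact le_trans hσ.2 h

/-- Every fibre of `chi` over a point of its image contains a semisimple representation. -/
theorem exists_isSemisimple_chi_eq [Group.FG Γ] (ρ : RepVar Γ n) :
    ∃ σ : RepVar Γ n, IsSemisimple σ ∧ chi σ = chi ρ := by
  obtain ⟨S, hS⟩ := (Group.fg_iff_monoid_fg.1 ‹Group.FG Γ›).fg_top
  obtain ⟨σ, hσ, hmin⟩ := exists_minimal_chi_eq hS ρ
  refine ⟨σ, isSemisimple_iff.2 fun U hU => ?_, hσ⟩
  obtain ⟨p, hp, hpH, hpU, hpid⟩ := exists_orthogonalProjection U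
  have hpσ : ∀ γ, p * (σ γ : Matrix (Fin n) (Fin n) ℂ) * p =
      (σ γ : Matrix (Fin n) (Fin n) ℂ) * p := fun γ => by
    refine Matrix.toLin'.injective (LinearMap.ext fun v => ?_)
    simp only [Matrix.toLin'_apply, ← Matrix.mulVec_mulVec]
    exact hpid _ (hU γ _ (hpU v))
  -- The block diagonal part stays in the fibre and loses exactly the squared norm of the
  -- off-diagonal block. By minimality that block is zero on generators, so `p` commutes with `σ`.
  obtain ⟨τ, hτ, hτσ⟩ := exists_blockDiagonal_chi_eq σ hp hpσ
  have hle := hmin τ (hτ.trans hσ)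
  rw [Finset.sum_congr rfl fun γ _ => frobSq_eq_add hp hpH (hpσ γ)] at hle
  simp only [← hτσ, Finset.sum_add_distrib] at hle
  have hzero := (Finset.sum_eq_zero_iff_of_nonneg fun γ _ => frobSq_nonneg
    (p * (σ γ : Matrix (Fin n) (Fin n) ℂ) * (1 - p))).1
    (le_antisymm (by linarith) (Finset.sum_nonneg fun γ _ => frobSq_nonneg _))
  refine ⟨p, fun γ => ?_, hpU, hpid⟩
  have hγ : γ ∈ Submonoid.closure (S : Set Γ) := hS ▸ Submonoid.mem_top γ
  induction hγ using Submonoid.closure_induction with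
  | mem δ hδ =>
    have := eq_zero_of_frobSq_eq_zero (hzero δ hδ)
    rw [mul_sub, mul_one, sub_eq_zero] at this
    exact this.trans (hpσ δ)
  | one => simp
  | mul a b _ _ ha hb =>
    rw [map_mul, Units.val_mul]
    exact ha.mul_right hb

end KempfNess

/-! ### Weyl's unitary trick -/

section UnitaryTrick

open Filter Topology ComplexOrder

variable {Γ : Type*} [Group Γ] {n : ℕ}

/-- The complex one-parameter group `s ↦ diag(exp(s μᵢ))`. -/
def diagExp (μ : Fin n → ℂ) (s : ℂ) : GL (Fin n) ℂ where
  val := diagonal fun i => Complex.exp (s * μ i)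
  inv := diagonal fun i => Complex.exp (-(s * μ i))
  val_inv := by simp [Matrix.diagonal_mul_diagonal, ← Complex.exp_add]
  inv_val := by simp [Matrix.diagonal_mul_diagonal, ← Complex.exp_add]

theorem conjRep_diagExp_apply (μ : Fin n → ℂ) (s : ℂ) (σ : RepVar Γ n) (γ : Γ) (i j : Fin n) :
    (conjRep (diagExp μ s) σ γ : Matrix (Fin n) (Fin n) ℂ) i j =
      Complex.exp (s * μ i) * (σ γ : Matrix (Fin n) (Fin n) ℂ) i j * Complex.exp (-(s * μ j)) := by
  have : (conjRep (diagExp μ s) σ γ : Matrix (Fin n) (Fin n) ℂ) =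
    (diagonal fun i => Complex.exp (s * μ i)) * (σ γ : Matrix (Fin n) (Fin n) ℂ) *
      (diagonal fun i => Complex.exp (-(s * μ i))) := rfl
  rw [this, Matrix.mul_diagonal, Matrix.diagonal_mul]

/-- Needed for the identity theorem, which carries invariance from imaginary `s`, where the matrix
is unitary for real `μ`, to `s = 1`. -/
theorem analyticOnNhd_conjRep_diagExp {f : RepVar Γ n → ℂ} (hf : f ∈ regularFunctions Γ n)
    (μ : Fin n → ℂ) (σ : RepVar Γ n) :
    AnalyticOnNhd ℂ (fun s => f (conjRep (diagExp μ s) σ)) Set.univ := by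
  unfold regularFunctions at hf
  induction hf using Algebra.adjoin_induction with
  | mem x hx =>
    obtain ⟨γ, i, j, rfl⟩ := hx
    simp only [conjRep_diagExp_apply]
    intro s _
    fun_prop
  | algebraMap r => exact analyticOnNhd_const
  | add x y _ _ hx hy => exact hx.add hy
  | mul x y _ _ hx hy => exact hx.mul hy

/-- Conjugation by a unitary matrix. -/
abbrev unitaryConj (u : unitaryGroup (Fin n) ℂ) (ρ : RepVar Γ n) : RepVar Γ n :=
  conjRep (Unitary.toUnits u) ρ

/-- A regular function invariant under unitary conjugation is invariant under conjugation by
positive diagonal matrices. -/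
theorem apply_conjRep_diagExp_one {f : RepVar Γ n → ℂ} (hf : f ∈ regularFunctions Γ n)
    (hu : ∀ (u : unitaryGroup (Fin n) ℂ) (ρ : RepVar Γ n), f (unitaryConj u ρ) = f ρ)
    (μ : Fin n → ℝ) (σ : RepVar Γ n) :
    f (conjRep (diagExp (fun i => (μ i : ℂ)) 1) σ) = f σ := by
  have him : ∀ t : ℝ, f (conjRep (diagExp (fun i => (μ i : ℂ)) (t * Complex.I)) σ) = f σ := by
    intro t
    have hmem : ((diagExp (fun i => (μ i : ℂ)) (t * Complex.I) : GL (Fin n) ℂ) :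
        Matrix (Fin n) (Fin n) ℂ) ∈ unitaryGroup (Fin n) ℂ := by
      rw [Matrix.mem_unitaryGroup_iff, Matrix.star_eq_conjTranspose]
      simp only [diagExp, Matrix.diagonal_conjTranspose, Matrix.diagonal_mul_diagonal]
      rw [← Matrix.diagonal_one]
      congr 1
      ext i
      simp only [Pi.star_apply, Complex.star_def, ← Complex.exp_conj, ← Complex.exp_add, map_mul,
        Complex.conj_ofReal, Complex.conj_I]
      rw [show (t : ℂ) * Complex.I * μ i + t * -Complex.I * μ i = 0 by ring, Complex.exp_zero]
    rw [← hu ⟨_, hmem⟩ σ]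
    congr 2
    ext1
    rfl
  -- The points `i/(k+1)` accumulate at `0`, so the entire function is constant.
  have heq := (analyticOnNhd_conjRep_diagExp hf (fun i => (μ i : ℂ)) σ).eq_of_frequently_eq
    (g := fun _ => f σ) (z₀ := 0) analyticOnNhd_const (by
      have hlim : Tendsto (fun k : ℕ => (((1 / ((k : ℝ) + 1) : ℝ) : ℂ) * Complex.I)) atTop
          (𝓝[≠] 0) := by
        refine tendsto_nhdsWithin_iff.2 ⟨?_, Eventually.of_forall fun k => ?_⟩
        · have h0 := (Complex.continuous_ofReal.tendsto _).comp
            (tendsto_one_div_add_atTop_nhds_zero_nat (𝕜 := ℝ))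
          have := h0.mul_const Complex.I
          simpa using this
        · have : (1 / ((k : ℝ) + 1) : ℝ) ≠ 0 := Nat.one_div_pos_of_nat.ne'
          exact mul_ne_zero (Complex.ofReal_ne_zero.2 this) Complex.I_ne_zero
      exact hlim.frequently (Frequently.of_forall fun k => him _))
  exact congrFun heq 1

/-- A regular function invariant under unitary conjugation is invariant under conjugation. -/
theorem apply_conjRep_of_unitary_invariant {f : RepVar Γ n → ℂ} (hf : f ∈ regularFunctions Γ n)
    (hu : ∀ (u : unitaryGroup (Fin n) ℂ) (ρ : RepVar Γ n), f (unitaryConj u ρ) = f ρ)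
    (g : GL (Fin n) ℂ) (ρ : RepVar Γ n) : f (conjRep g ρ) = f ρ := by
  have hpos : ((g : Matrix (Fin n) (Fin n) ℂ)ᴴ * (g : Matrix (Fin n) (Fin n) ℂ)).PosDef :=
    Matrix.PosDef.conjTranspose_mul_self _ (Matrix.mulVec_injective_of_isUnit g.isUnit)
  let V := hpos.isHermitian.eigenvectorUnitary
  -- The half logarithm makes `D` the diagonal matrix of singular values of `g`. Then `g V D⁻¹` is
  -- unitary, giving a singular value decomposition of `g`.
  let μ : Fin n → ℝ := fun i => Real.log (hpos.isHermitian.eigenvalues i) / 2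
  let D : GL (Fin n) ℂ := diagExp (fun i => (μ i : ℂ)) 1
  let D' : Matrix (Fin n) (Fin n) ℂ := diagonal fun i => Complex.exp (-(1 * (μ i : ℂ)))
  have hDinv : ((D⁻¹ : GL (Fin n) ℂ) : Matrix (Fin n) (Fin n) ℂ) = D' := rfl
  have hspec : (V : Matrix (Fin n) (Fin n) ℂ)ᴴ *
      ((g : Matrix (Fin n) (Fin n) ℂ)ᴴ * (g : Matrix (Fin n) (Fin n) ℂ)) *
        (V : Matrix (Fin n) (Fin n) ℂ) =
      diagonal fun i => ((hpos.isHermitian.eigenvalues i : ℝ) : ℂ) := by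
    have := hpos.isHermitian.conjStarAlgAut_star_eigenvectorUnitary
    rw [Unitary.conjStarAlgAut_star_apply] at this
    exact this
  have hD'H : D'ᴴ = D' := by
    simp only [D', Matrix.diagonal_conjTranspose]
    congr 1
    ext i
    simp [← Complex.exp_conj]
  have hW : (g : Matrix (Fin n) (Fin n) ℂ) * (V : Matrix (Fin n) (Fin n) ℂ) * D' ∈
      unitaryGroup (Fin n) ℂ := by
    rw [Matrix.mem_unitaryGroup_iff', Matrix.star_eq_conjTranspose, conjTranspose_mul,
      conjTranspose_mul, hD'H]
    calc D' * ((V : Matrix (Fin n) (Fin n) ℂ)ᴴ * (g : Matrix (Fin n) (Fin n) ℂ)ᴴ) *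
          ((g : Matrix (Fin n) (Fin n) ℂ) * (V : Matrix (Fin n) (Fin n) ℂ) * D')
        = D' * ((V : Matrix (Fin n) (Fin n) ℂ)ᴴ *
          ((g : Matrix (Fin n) (Fin n) ℂ)ᴴ * (g : Matrix (Fin n) (Fin n) ℂ)) *
          (V : Matrix (Fin n) (Fin n) ℂ)) * D' := by simp only [mul_assoc]
      _ = 1 := by
        rw [hspec, Matrix.diagonal_mul_diagonal, Matrix.diagonal_mul_diagonal,
          ← Matrix.diagonal_one]
        congr 1
        ext i
        have hi := hpos.eigenvalues_pos i
        have : ((hpos.isHermitian.eigenvalues i : ℝ) : ℂ) =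
            Complex.exp (μ i : ℂ) * Complex.exp (μ i : ℂ) := by
          rw [← Complex.exp_add, ← Complex.ofReal_add, ← Complex.ofReal_exp]
          simp [μ, Real.exp_log hi]
        rw [this, ← Complex.exp_add, ← Complex.exp_add, ← Complex.exp_add]
        ring_nf
        simp
  have hg : g = Unitary.toUnits (⟨_, hW⟩ : unitaryGroup (Fin n) ℂ) *
      (D * (Unitary.toUnits V)⁻¹) := by
    rw [← mul_assoc, eq_mul_inv_iff_mul_eq, ← mul_inv_eq_iff_eq_mul]
    ext1
    rfl
  rw [hg, conjRep_mul, hu ⟨_, hW⟩, conjRep_mul, apply_conjRep_diagExp_one hf hu, ← map_inv, hu]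

end UnitaryTrick

/-! ### The Reynolds operator by averaging over the unitary group -/

section Reynolds

open MeasureTheory

/-- A compact group carries a normalized invariant mean on its continuous functions. -/
theorem exists_invariant_mean (K : Type*) [Group K] [TopologicalSpace K] [IsTopologicalGroup K]
    [CompactSpace K] :
    ∃ I : C(K, ℂ) →ₗ[ℂ] ℂ, I 1 = 1 ∧
      ∀ (g : K) (f h : C(K, ℂ)), (∀ u, h u = f (g * u)) → I h = I f := by
  let _ : MeasurableSpace K := borel K
  have : BorelSpace K := ⟨rfl⟩
  let μ : Measure K := Measure.haarMeasure ⊤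
  have hμ : μ Set.univ = 1 := Measure.haarMeasure_self (K₀ := (⊤ : TopologicalSpace.PositiveCompacts K))
  have : IsProbabilityMeasure μ := ⟨hμ⟩
  have hint : ∀ f : C(K, ℂ), Integrable f μ := fun f =>
    f.continuous.integrable_of_hasCompactSupport (HasCompactSupport.of_compactSpace f)
  refine ⟨⟨⟨fun f => ∫ u, f u ∂μ, fun f h => integral_add (hint f) (hint h)⟩,
    fun c f => integral_const_mul c _⟩, by simp, fun g f h hfh => ?_⟩
  simp only [LinearMap.coe_mk, AddHom.coe_mk, hfh]
  exact integral_mul_left_eq_self (μ := μ) f g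

theorem compactSpace_unitaryGroup (n : ℕ) : CompactSpace (unitaryGroup (Fin n) ℂ) := by
  refine isCompact_iff_compactSpace.1 ?_
  have hbox : IsCompact (Set.univ.pi fun _ => Set.univ.pi fun _ =>
      Metric.closedBall (0 : ℂ) 1 : Set (Fin n → Fin n → ℂ)) :=
    isCompact_univ_pi fun _ => isCompact_univ_pi fun _ => isCompact_closedBall _ _
  refine IsCompact.of_isClosed_subset (X := Matrix (Fin n) (Fin n) ℂ) hbox isClosed_unitary ?_
  intro u hu i _ j _
  simpa using entry_norm_bound_of_unitary hu i j

variable {Γ : Type*} [Group Γ] {n : ℕ}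

/-- Pulling a regular function back along the conjugation action of the unitary group separates the
variables. -/
theorem exists_unitaryConj_eq_sum {f : RepVar Γ n → ℂ} (hf : f ∈ regularFunctions Γ n) :
    ∃ (ι : Type) (_ : Fintype ι) (c : ι → C(unitaryGroup (Fin n) ℂ, ℂ)) (h : ι → RepVar Γ n → ℂ),
      (∀ k, h k ∈ regularFunctions Γ n) ∧
        ∀ u ρ, f (unitaryConj u⁻¹ ρ) = ∑ k, c k u * h k ρ := by
  unfold regularFunctions at hf
  induction hf using Algebra.adjoin_induction with
  | mem x hx =>
    obtain ⟨γ, i, j, rfl⟩ := hx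
    refine ⟨Fin n × Fin n, inferInstance,
      fun k => ⟨fun u => (star (u : Matrix (Fin n) (Fin n) ℂ)) i k.1 *
        (u : Matrix (Fin n) (Fin n) ℂ) k.2 j, ?_⟩,
      fun k ρ => (ρ γ : Matrix (Fin n) (Fin n) ℂ) k.1 k.2,
      fun k => entry_mem_regularFunctions γ k.1 k.2, fun u ρ => ?_⟩
    · have h1 : Continuous fun u : unitaryGroup (Fin n) ℂ => (u : Matrix (Fin n) (Fin n) ℂ) :=
        continuous_subtype_val
      exact (h1.star.matrix_elem i k.1).mul (h1.matrix_elem k.2 j)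
    · have : (unitaryConj u⁻¹ ρ γ : Matrix (Fin n) (Fin n) ℂ) =
          star (u : Matrix (Fin n) (Fin n) ℂ) * (ρ γ : Matrix (Fin n) (Fin n) ℂ) *
            (u : Matrix (Fin n) (Fin n) ℂ) := by
        simp [unitaryConj, coe_conjRep]
      simp only [this, Matrix.mul_apply, Finset.sum_mul, ContinuousMap.coe_mk]
      rw [Finset.sum_comm, Fintype.sum_prod_type]
      refine Finset.sum_congr rfl fun a _ => Finset.sum_congr rfl fun b _ => ?_
      ring
  | algebraMap r =>
    exact ⟨Unit, inferInstance, fun _ => 1, fun _ => algebraMap ℂ _ r,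
      fun _ => Subalgebra.algebraMap_mem _ r, fun u ρ => by simp⟩
  | add x y _ _ hx hy =>
    obtain ⟨ι, _, c, h, hh, hx⟩ := hx
    obtain ⟨ι', _, c', h', hh', hy⟩ := hy
    refine ⟨ι ⊕ ι', inferInstance, Sum.elim c c', Sum.elim h h', ?_, fun u ρ => ?_⟩
    · rintro (k | k)
      · exact hh k
      · exact hh' k
    · simp [hx, hy]
  | mul x y _ _ hx hy =>
    obtain ⟨ι, _, c, h, hh, hx⟩ := hx
    obtain ⟨ι', _, c', h', hh', hy⟩ := hy
    refine ⟨ι × ι', inferInstance, fun k => c k.1 * c' k.2, fun k => h k.1 * h' k.2,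
      fun k => mul_mem (hh k.1) (hh' k.2), fun u ρ => ?_⟩
    rw [Pi.mul_apply, hx, hy, Finset.sum_mul_sum, Fintype.sum_prod_type]
    refine Finset.sum_congr rfl fun a _ => Finset.sum_congr rfl fun b _ => ?_
    simp only [ContinuousMap.mul_apply, Pi.mul_apply]
    ring

/-- The function `u ↦ f(u⁻¹ ρ u)` on the unitary group. -/
def orbitMap (ρ : RepVar Γ n) : regularFunctions Γ n →ₗ[ℂ] C(unitaryGroup (Fin n) ℂ, ℂ) where
  toFun f := ⟨fun u => (f : RepVar Γ n → ℂ) (unitaryConj u⁻¹ ρ), by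
    obtain ⟨ι, _, c, h, -, hf⟩ := exists_unitaryConj_eq_sum f.2
    simp only [hf]
    fun_prop⟩
  map_add' _ _ := rfl
  map_smul' _ _ := rfl

/-- The Reynolds operator. -/
theorem exists_reynolds (Γ : Type*) [Group Γ] (n : ℕ) :
    ∃ E : regularFunctions Γ n →ₗ[ℂ] (RepVar Γ n → ℂ), (∀ r, E r ∈ invariantFunctions Γ n) ∧
      E 1 = 1 ∧ ∀ f r : regularFunctions Γ n, (f : RepVar Γ n → ℂ) ∈ invariantFunctions Γ n →
        E (f * r) = (f : RepVar Γ n → ℂ) * E r := by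
  have := compactSpace_unitaryGroup n
  obtain ⟨I, hI1, hIinv⟩ := exists_invariant_mean (unitaryGroup (Fin n) ℂ)
  refine ⟨LinearMap.pi fun ρ => I.comp (orbitMap ρ), fun r => ?_, ?_, fun f r hf => ?_⟩
  · have hreg : (LinearMap.pi fun ρ => I.comp (orbitMap ρ)) r ∈ regularFunctions Γ n := by
      -- With the variables separated, the average is a finite linear combination of regular
      -- functions, hence regular.
      obtain ⟨ι, _, c, h, hh, hr⟩ := exists_unitaryConj_eq_sum r.2
      have : (LinearMap.pi fun ρ => I.comp (orbitMap ρ)) r = ∑ k, I (c k) • h k := by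
        ext ρ
        have h1 : orbitMap ρ r = ∑ k, h k ρ • c k := by
          ext u
          simp only [orbitMap, LinearMap.coe_mk, AddHom.coe_mk, ContinuousMap.coe_mk, hr,
            ContinuousMap.coe_sum, Finset.sum_apply, ContinuousMap.coe_smul, Pi.smul_apply,
            smul_eq_mul, mul_comm]
        simp only [LinearMap.pi_apply, LinearMap.comp_apply, h1, map_sum, map_smul,
          Finset.sum_apply, Pi.smul_apply, smul_eq_mul, mul_comm]
      rw [this]
      exact sum_mem fun k _ => Subalgebra.smul_mem _ (hh k) _
    refine ⟨hreg, apply_conjRep_of_unitary_invariant hreg fun v ρ => ?_⟩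
    -- Because `orbitMap` conjugates by `u⁻¹`, replacing `ρ` by its conjugate under `v` is left
    -- translation by `v⁻¹`.
    refine hIinv v⁻¹ _ _ fun u => ?_
    change (r : RepVar Γ n → ℂ) (unitaryConj u⁻¹ (unitaryConj v ρ)) =
      (r : RepVar Γ n → ℂ) (unitaryConj (v⁻¹ * u)⁻¹ ρ)
    rw [unitaryConj, unitaryConj, ← conjRep_mul, ← map_mul, _root_.mul_inv_rev, inv_inv]
  · ext ρ
    exact hI1
  · ext ρ
    have h1 : orbitMap ρ (f * r) = (f : RepVar Γ n → ℂ) ρ • orbitMap ρ r := by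
      ext u
      change (f : RepVar Γ n → ℂ) (unitaryConj u⁻¹ ρ) * (r : RepVar Γ n → ℂ) (unitaryConj u⁻¹ ρ) =
        (f : RepVar Γ n → ℂ) ρ * (r : RepVar Γ n → ℂ) (unitaryConj u⁻¹ ρ)
      rw [hf.2]
    simp [h1]

end Reynolds

/-! ### Points of the quotient come from representations -/

section Surjectivity

variable {Γ : Type*} [Group Γ] {n : ℕ}

/-- Entries of a product are polynomials in the entries of the factors, so the entries at finitely
many monoid generators suffice. -/
theorem finiteType_regularFunctions (Γ : Type*) [Group Γ] [Group.FG Γ] (n : ℕ) :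
    Algebra.FiniteType ℂ (regularFunctions Γ n) := by
  obtain ⟨S, hS⟩ := (Group.fg_iff_monoid_fg.1 ‹Group.FG Γ›).fg_top
  let ev : Γ × Fin n × Fin n → RepVar Γ n → ℂ :=
    fun k ρ => (ρ k.1 : Matrix (Fin n) (Fin n) ℂ) k.2.1 k.2.2
  let T : Set (RepVar Γ n → ℂ) := ev '' ((S : Set Γ) ×ˢ Set.univ)
  have hT : T.Finite := (S.finite_toSet.prod Set.finite_univ).image _
  have hTR : Algebra.adjoin ℂ T = regularFunctions Γ n := by
    refine le_antisymm (Algebra.adjoin_mono ?_) (Algebra.adjoin_le ?_)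
    · rintro _ ⟨k, -, rfl⟩
      exact ⟨k.1, k.2.1, k.2.2, rfl⟩
    · rintro _ ⟨γ, i, j, rfl⟩
      have hγ : γ ∈ Submonoid.closure (S : Set Γ) := hS ▸ Submonoid.mem_top γ
      induction hγ using Submonoid.closure_induction generalizing i j with
      | mem δ hδ => exact Algebra.subset_adjoin ⟨(δ, i, j), ⟨hδ, trivial⟩, rfl⟩
      | one =>
        simp only [map_one, Units.val_one]
        exact Subalgebra.algebraMap_mem _ ((1 : Matrix (Fin n) (Fin n) ℂ) i j)
      | mul a b _ _ ha hb =>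
        have : (fun ρ : RepVar Γ n => (ρ (a * b) : Matrix (Fin n) (Fin n) ℂ) i j) =
            ∑ k, (fun ρ : RepVar Γ n => (ρ a : Matrix (Fin n) (Fin n) ℂ) i k) *
              fun ρ : RepVar Γ n => (ρ b : Matrix (Fin n) (Fin n) ℂ) k j := by
          ext ρ
          simp [Matrix.mul_apply]
        rw [this]
        exact sum_mem fun k _ => mul_mem (ha i k) (hb k j)
  rw [← Subalgebra.fg_iff_finiteType, ← hTR]
  exact Subalgebra.fg_def.2 ⟨T, hT, rfl⟩

/-- The complex points of the representation variety are representations. -/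
theorem exists_rep_of_algHom (y : regularFunctions Γ n →ₐ[ℂ] ℂ) :
    ∃ ρ : RepVar Γ n, ∀ f : regularFunctions Γ n, y f = (f : RepVar Γ n → ℂ) ρ := by
  let ent : Γ → Fin n → Fin n → regularFunctions Γ n :=
    fun γ i j => ⟨_, entry_mem_regularFunctions γ i j⟩
  -- Apply `y` entrywise to the tautological matrices; their multiplicativity is an identity in the
  -- ring of regular functions.
  let m : Γ →* Matrix (Fin n) (Fin n) ℂ :=
    { toFun := fun γ => Matrix.of fun i j => y (ent γ i j)
      map_one' := by
        ext i j
        have : ent 1 i j = algebraMap ℂ _ ((1 : Matrix (Fin n) (Fin n) ℂ) i j) := by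
          ext ρ
          simp [ent]
        rw [Matrix.of_apply, this, AlgHom.commutes]
        rfl
      map_mul' := fun γ δ => by
        ext i j
        have : ent (γ * δ) i j = ∑ k, ent γ i k * ent δ k j := by
          ext ρ
          simp [ent, Matrix.mul_apply]
        rw [Matrix.of_apply, this, map_sum, Matrix.mul_apply]
        simp }
  refine ⟨m.toHomUnits, fun ⟨f, hf⟩ => ?_⟩
  have hf' : f ∈ Algebra.adjoin ℂ {f : RepVar Γ n → ℂ | ∃ (γ : Γ) (i j : Fin n),
    f = fun ρ => (ρ γ : Matrix (Fin n) (Fin n) ℂ) i j} := hf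
  induction hf' using Algebra.adjoin_induction with
  | mem x hx =>
    obtain ⟨γ, i, j, rfl⟩ := hx
    rfl
  | algebraMap r => exact y.commutes r
  | add a b ha hb iha ihb =>
    have := map_add y ⟨a, ha⟩ ⟨b, hb⟩
    rw [iha ha, ihb hb] at this
    exact this
  | mul a b ha hb iha ihb =>
    have := map_mul y ⟨a, ha⟩ ⟨b, hb⟩
    rw [iha ha, ihb hb] at this
    exact this

theorem invariantFunctions_le : invariantFunctions Γ n ≤ regularFunctions Γ n := fun _ h => h.1

/-- The weak Nullstellensatz: maximal ideals of a finitely generated `ℂ`-algebra are complex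
points. -/
theorem exists_algHom_of_isMaximal {R : Type*} [CommRing R] [Algebra ℂ R] [Algebra.FiniteType ℂ R]
    (M : Ideal R) [hM : M.IsMaximal] : ∃ y : R →ₐ[ℂ] ℂ, ∀ r ∈ M, y r = 0 := by
  let _ := Ideal.Quotient.field M
  have := finite_of_finite_type_of_isJacobsonRing ℂ (R ⧸ M)
  have hbij := IsAlgClosed.algebraMap_bijective_of_isIntegral (k := ℂ) (K := R ⧸ M)
  refine ⟨((AlgEquiv.ofBijective (Algebra.ofId ℂ (R ⧸ M)) hbij).symm.toAlgHom).comp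
    (Ideal.Quotient.mkₐ ℂ M), fun r hr => ?_⟩
  have : Ideal.Quotient.mkₐ ℂ M r = 0 := Ideal.Quotient.eq_zero_iff_mem.2 hr
  rw [AlgHom.comp_apply, this, map_zero]

/-- Every point of the character variety is the image of a representation. -/
theorem chi_surjective [Group.FG Γ] :
    Function.Surjective (chi : RepVar Γ n → CharacterVariety Γ n) := by
  intro x
  obtain ⟨E, hEinv, hE1, hEmul⟩ := exists_reynolds Γ n
  let incl := Subalgebra.inclusion (invariantFunctions_le (Γ := Γ) (n := n))
  let J : Ideal (regularFunctions Γ n) := Ideal.map incl (RingHom.ker x)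
  -- `E` is linear over invariants, so `x ∘ E` kills the extended ideal. As `E 1 = 1`, that ideal is
  -- proper.
  have hJ : ∀ r ∈ J, ∀ a, x ⟨E (a * r), hEinv _⟩ = 0 := by
    intro r hr
    refine Submodule.span_induction ?_ ?_ ?_ ?_ hr
    · rintro _ ⟨f, hf, rfl⟩ a
      have : (⟨E (a * incl f), hEinv _⟩ : invariantFunctions Γ n) = f * ⟨E a, hEinv _⟩ := by
        refine Subtype.ext ?_
        rw [mul_comm a]
        exact hEmul (incl f) a f.2
      have hf0 : x f = 0 := hf
      change x ⟨E (a * incl f), hEinv _⟩ = 0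
      rw [this, map_mul, hf0, zero_mul]
    · intro a
      have : (⟨E (a * 0), hEinv _⟩ : invariantFunctions Γ n) = 0 := Subtype.ext (by simp)
      rw [this, map_zero]
    · intro r s _ _ hr hs a
      have : (⟨E (a * (r + s)), hEinv _⟩ : invariantFunctions Γ n) =
          ⟨E (a * r), hEinv _⟩ + ⟨E (a * s), hEinv _⟩ := Subtype.ext (by simp [mul_add])
      rw [this, map_add, hr, hs, add_zero]
    · intro b r _ hr a
      have : (⟨E (a * b • r), hEinv _⟩ : invariantFunctions Γ n) = ⟨E ((a * b) * r), hEinv _⟩ :=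
        Subtype.ext (by rw [smul_eq_mul, mul_assoc])
      rw [this, hr]
  have hne : J ≠ ⊤ := by
    intro htop
    have h1 := hJ 1 (htop ▸ Submodule.mem_top) 1
    have : (⟨E (1 * 1), hEinv _⟩ : invariantFunctions Γ n) = 1 :=
      Subtype.ext ((congrArg E (mul_one 1)).trans hE1)
    rw [this, map_one] at h1
    exact one_ne_zero h1
  obtain ⟨M, hM, hJM⟩ := Ideal.exists_le_maximal J hne
  have := finiteType_regularFunctions Γ n
  obtain ⟨y, hy⟩ := exists_algHom_of_isMaximal M
  obtain ⟨ρ, hρ⟩ := exists_rep_of_algHom y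
  refine ⟨ρ, AlgHom.ext fun f => ?_⟩
  -- Since `f - x(f)` lies in `ker x`, the point `y` kills it, and `y` restricts to `x` on
  -- invariants.
  have hmem : incl (f - algebraMap ℂ _ (x f)) ∈ J := Ideal.mem_map_of_mem incl (by
    change x (f - algebraMap ℂ _ (x f)) = 0
    rw [map_sub, AlgHom.commutes]
    exact sub_self _)
  have h0 := hy _ (hJM hmem)
  rw [map_sub, map_sub, AlgHom.commutes, AlgHom.commutes, sub_eq_zero, hρ] at h0
  exact h0

end Surjectivity

/-! ### Invariant hermitian forms and their signature -/

section HermitianForm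

variable {n : ℕ}

/-- A complex combination `A + i B` which is invertible can be replaced by a real one. -/
theorem exists_real_det_ne_zero {A B : Matrix (Fin n) (Fin n) ℂ}
    (h : (A + Complex.I • B).det ≠ 0) : ∃ t : ℝ, (A + (t : ℂ) • B).det ≠ 0 := by
  -- The determinant of the pencil is a polynomial, nonzero at `i`, so it cannot vanish on all of
  -- `ℝ`.
  let P : Polynomial ℂ :=
    (A.map Polynomial.C + (Polynomial.X : Polynomial ℂ) • B.map Polynomial.C).det
  have hP : ∀ z : ℂ, P.eval z = (A + z • B).det := fun z => by
    rw [← Polynomial.coe_evalRingHom, RingHom.map_det]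
    congr 1
    ext i j
    simp only [Polynomial.coe_evalRingHom, RingHom.mapMatrix_apply, Matrix.map_apply, Matrix.add_apply,
      Matrix.smul_apply, smul_eq_mul, Polynomial.eval_add, Polynomial.eval_mul, Polynomial.eval_X,
      Polynomial.eval_C]
  by_contra! hall
  have hP0 : P = 0 := by
    refine Polynomial.eq_zero_of_infinite_isRoot P (Set.Infinite.mono ?_
      (Set.infinite_range_of_injective Complex.ofReal_injective))
    rintro _ ⟨t, rfl⟩
    exact (hP t).trans (hall t)
  exact h (by rw [← hP, hP0, Polynomial.eval_zero])

/-- The signature matrix `I_{p,q}` is diagonal. -/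
theorem Ipq_eq_diagonal {p q : ℕ} (h : p + q = n) :
    Ipq p q h = diagonal fun i =>
      Sum.elim (fun _ => (1 : ℂ)) (fun _ => -1) ((finSumFinEquiv.trans (finCongr h)).symm i) := by
  have : (fromBlocks (1 : Matrix (Fin p) (Fin p) ℂ) 0 0 (-1 : Matrix (Fin q) (Fin q) ℂ)) =
      diagonal (Sum.elim (fun _ => (1 : ℂ)) fun _ => -1) := by
    rw [← fromBlocks_diagonal]
    congr 1
    ext i j
    by_cases hij : i = j <;> simp [hij]
  rw [Ipq, this, Matrix.reindex_apply, Matrix.submatrix_diagonal_equiv]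
  rfl

/-- Sylvester's law of inertia: a nondegenerate hermitian form is congruent to some `I_{p,q}`. -/
theorem exists_congruent_Ipq {H : Matrix (Fin n) (Fin n) ℂ} (hH : H.IsHermitian)
    (hdet : H.det ≠ 0) :
    ∃ (p q : ℕ) (h : p + q = n) (P : GL (Fin n) ℂ),
      (P : Matrix (Fin n) (Fin n) ℂ)ᴴ * Ipq p q h * P = H := by
  let V := hH.eigenvectorUnitary
  let ev := hH.eigenvalues
  let p := Fintype.card {i // 0 < ev i}
  -- Zero eigenvalues need not be excluded here; nondegeneracy of `H` enters only to make `Q`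
  -- invertible.
  let q := Fintype.card {i // ¬ 0 < ev i}
  have h : p + q = n := by
    have := Fintype.card_congr (Equiv.sumCompl fun i => 0 < ev i)
    rwa [Fintype.card_sum, Fintype.card_fin] at this
  -- This permutation moves the positive eigenvalues to the first `p` places.
  let e : Fin n ≃ Fin n := (Equiv.sumCompl fun i => 0 < ev i).symm.trans
    (((Fintype.equivFin {i // 0 < ev i}).sumCongr (Fintype.equivFin {i // ¬ 0 < ev i})).trans
      (finSumFinEquiv.trans (finCongr h)))
  let d : Fin n → ℂ := fun i =>
    Sum.elim (fun _ => (1 : ℂ)) (fun _ => -1) ((finSumFinEquiv.trans (finCongr h)).symm i)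
  have hd : ∀ i, d (e i) * (|ev i| : ℝ) = (ev i : ℂ) := by
    intro i
    by_cases hi : 0 < ev i
    · have : d (e i) = 1 := by
        have hs : (Equiv.sumCompl fun i => 0 < ev i).symm i = Sum.inl ⟨i, hi⟩ := by
          rw [Equiv.symm_apply_eq]
          rfl
        simp only [d, e, Equiv.trans_apply, hs, Equiv.symm_trans_apply, Equiv.symm_apply_apply]
        rfl
      rw [this, one_mul, abs_of_pos hi]
    · have : d (e i) = -1 := by
        have hs : (Equiv.sumCompl fun i => 0 < ev i).symm i = Sum.inr ⟨i, hi⟩ := by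
          rw [Equiv.symm_apply_eq]
          rfl
        simp only [d, e, Equiv.trans_apply, hs, Equiv.symm_trans_apply, Equiv.symm_apply_apply]
        rfl
      rw [this, abs_of_nonpos (not_lt.1 hi)]
      push_cast
      ring
  -- `Q = π D Vᴴ` with `π` the permutation matrix of `e` and `D = diag(√|λᵢ|)`
  let s : Fin n → ℂ := fun i => ((Real.sqrt |ev i| : ℝ) : ℂ)
  let Q : Matrix (Fin n) (Fin n) ℂ :=
    (diagonal s).submatrix e.symm id * star (V : Matrix (Fin n) (Fin n) ℂ)
  have hcore : ((diagonal s).submatrix e.symm id)ᴴ * Ipq p q h * (diagonal s).submatrix e.symm id =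
      diagonal fun i => (ev i : ℂ) := by
    have h1 : ((diagonal s).submatrix e.symm id)ᴴ = ((diagonal s)ᴴ).submatrix id e.symm := rfl
    have h2 : Ipq p q h = (diagonal fun i => d (e i)).submatrix e.symm e.symm := by
      rw [Ipq_eq_diagonal, Matrix.submatrix_diagonal_equiv]
      congr 1
      ext i
      simp [d]
    rw [h1, h2, Matrix.submatrix_mul_equiv, Matrix.submatrix_mul_equiv, Matrix.submatrix_id_id,
      Matrix.diagonal_conjTranspose, Matrix.diagonal_mul_diagonal, Matrix.diagonal_mul_diagonal]
    congr 1
    ext i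
    rw [← hd i]
    have h3 : star (s i) = s i := Complex.conj_ofReal _
    have h4 : s i * s i = ((|ev i| : ℝ) : ℂ) := by
      rw [← Complex.ofReal_mul, Real.mul_self_sqrt (abs_nonneg _)]
    rw [Pi.star_apply, h3, ← h4]
    ring
  have hQ : Qᴴ * Ipq p q h * Q = H := by
    have hs := hH.spectral_theorem
    rw [Unitary.conjStarAlgAut_apply] at hs
    calc Qᴴ * Ipq p q h * Q
        = (V : Matrix (Fin n) (Fin n) ℂ) * (((diagonal s).submatrix e.symm id)ᴴ * Ipq p q h *
            (diagonal s).submatrix e.symm id) * star (V : Matrix (Fin n) (Fin n) ℂ) := by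
          simp only [Q, conjTranspose_mul, Matrix.star_eq_conjTranspose,
            conjTranspose_conjTranspose, mul_assoc]
      _ = H := by
        rw [hcore]
        exact hs.symm
  have hQdet : Q.det ≠ 0 := by
    intro h0
    apply hdet
    rw [← hQ, Matrix.det_mul, h0, mul_zero]
  exact ⟨p, q, h, Matrix.GeneralLinearGroup.mkOfDetNeZero Q hQdet, hQ⟩

variable {Γ : Type*} [Group Γ]

/-- A representation conjugate to its image under `A ↦ (Aᴴ)⁻¹` preserves a nondegenerate hermitian
form. -/
theorem exists_invariant_hermitian {ρ : RepVar Γ n} {P : GL (Fin n) ℂ}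
    (h : conjRep P ρ = phi₂Rep ρ) :
    ∃ H : Matrix (Fin n) (Fin n) ℂ, H.IsHermitian ∧ H.det ≠ 0 ∧
      ∀ γ, (ρ γ : Matrix (Fin n) (Fin n) ℂ)ᴴ * H * (ρ γ : Matrix (Fin n) (Fin n) ℂ) = H := by
  let B : Matrix (Fin n) (Fin n) ℂ := P
  have hB : ∀ γ, (ρ γ : Matrix (Fin n) (Fin n) ℂ)ᴴ * B * (ρ γ : Matrix (Fin n) (Fin n) ℂ) = B := by
    intro γ
    have h1 : P * ρ γ * P⁻¹ = (star (ρ γ))⁻¹ := DFunLike.congr_fun h γ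
    have h2 : star (ρ γ) * P * ρ γ = P := by
      rw [mul_inv_eq_iff_eq_mul] at h1
      rw [mul_assoc, h1, mul_inv_cancel_left]
    exact congrArg Units.val h2
  have hBH : ∀ γ, (ρ γ : Matrix (Fin n) (Fin n) ℂ)ᴴ * Bᴴ * (ρ γ : Matrix (Fin n) (Fin n) ℂ) = Bᴴ := by
    intro γ
    have := congrArg conjTranspose (hB γ)
    simpa only [conjTranspose_mul, conjTranspose_conjTranspose, mul_assoc] using this
  -- Both matrices are hermitian and invariant, with `H₁ + i H₂ = 2B` invertible. A real `t` keeps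
  -- `H₁ + t H₂` hermitian as well as nondegenerate.
  let H₁ : Matrix (Fin n) (Fin n) ℂ := B + Bᴴ
  let H₂ : Matrix (Fin n) (Fin n) ℂ := Complex.I • (Bᴴ - B)
  have hH₁ : H₁ᴴ = H₁ := by simp [H₁, add_comm]
  have hH₂ : H₂ᴴ = H₂ := by
    simp only [H₂, conjTranspose_smul, conjTranspose_sub, conjTranspose_conjTranspose,
      Complex.star_def, Complex.conj_I, neg_smul, ← smul_neg, neg_sub]
  have hdet : (H₁ + Complex.I • H₂).det ≠ 0 := by
    have : H₁ + Complex.I • H₂ = (2 : ℂ) • B := by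
      simp only [H₁, H₂, smul_smul, Complex.I_mul_I]
      module
    rw [this, Matrix.det_smul]
    refine mul_ne_zero (pow_ne_zero _ two_ne_zero) ?_
    exact ((Matrix.isUnit_iff_isUnit_det _).1 P.isUnit).ne_zero
  obtain ⟨t, ht⟩ := exists_real_det_ne_zero hdet
  refine ⟨_, ?_, ht, fun γ => ?_⟩
  · rw [Matrix.IsHermitian, conjTranspose_add, conjTranspose_smul, hH₁, hH₂, Complex.star_def,
      Complex.conj_ofReal]
  · simp only [H₁, H₂, mul_add, add_mul, mul_sub, sub_mul, mul_smul_comm, smul_mul_assoc, hB, hBH]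

/-- A semisimple representation whose character is fixed by `Φ₂` is conjugate to a representation
in some `U(p,q)`. -/
theorem IsSemisimple.exists_conj_mem_Upq {ρ : RepVar Γ n} (hρ : IsSemisimple ρ)
    (h : Phi₂ (chi ρ) = chi ρ) :
    ∃ (p q : ℕ) (h : p + q = n) (P : GL (Fin n) ℂ), ∀ γ : Γ, P * ρ γ * P⁻¹ ∈ Upq p q h := by
  rw [Phi₂_chi] at h
  obtain ⟨g, hg⟩ := exists_conjRep_eq_of_chi_eq hρ hρ.phi₂Rep h.symm
  obtain ⟨H, hH, hdet, hinv⟩ := exists_invariant_hermitian hg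
  obtain ⟨p, q, hpq, P, hP⟩ := exists_congruent_Ipq hH hdet
  refine ⟨p, q, hpq, P, fun γ => ?_⟩
  have hPP : (P : Matrix (Fin n) (Fin n) ℂ) * ((P⁻¹ : GL (Fin n) ℂ) : Matrix (Fin n) (Fin n) ℂ) = 1 :=
    P.mul_inv
  have hPP' : ((P⁻¹ : GL (Fin n) ℂ) : Matrix (Fin n) (Fin n) ℂ)ᴴ *
      (P : Matrix (Fin n) (Fin n) ℂ)ᴴ = 1 := by
    rw [← conjTranspose_mul, hPP, conjTranspose_one]
  set x := (ρ γ : Matrix (Fin n) (Fin n) ℂ) with hx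
  set P' := ((P⁻¹ : GL (Fin n) ℂ) : Matrix (Fin n) (Fin n) ℂ) with hP'
  change ((P : Matrix (Fin n) (Fin n) ℂ) * x * P')ᴴ * Ipq p q hpq *
    ((P : Matrix (Fin n) (Fin n) ℂ) * x * P') = Ipq p q hpq
  calc ((P : Matrix (Fin n) (Fin n) ℂ) * x * P')ᴴ * Ipq p q hpq *
        ((P : Matrix (Fin n) (Fin n) ℂ) * x * P')
      = P'ᴴ * (xᴴ * ((P : Matrix (Fin n) (Fin n) ℂ)ᴴ * Ipq p q hpq * P) * x) * P' := by
        simp only [conjTranspose_mul, mul_assoc]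
    _ = (P'ᴴ * (P : Matrix (Fin n) (Fin n) ℂ)ᴴ) * Ipq p q hpq *
          ((P : Matrix (Fin n) (Fin n) ℂ) * P') := by
        rw [hP, hinv γ, ← hP]
        simp only [mul_assoc]
    _ = Ipq p q hpq := by rw [hPP, hPP', one_mul, mul_one]

/-- The characters of representations in `U(p,q)` are fixed by `Φ₂`. -/
theorem Phi₂_chi_of_mem_Upq {p q : ℕ} (h : p + q = n) {ρ : RepVar Γ n}
    (hρ : ∀ γ, ρ γ ∈ Upq p q h) : Phi₂ (chi ρ) = chi ρ := by
  have hsq : Ipq p q h * Ipq p q h = 1 := by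
    rw [Ipq_eq_diagonal, Matrix.diagonal_mul_diagonal, ← Matrix.diagonal_one]
    congr 1
    ext i
    rcases (finSumFinEquiv.trans (finCongr h)).symm i with k | k <;> simp
  -- The relation `Mᴴ I M = I` reads `(Mᴴ)⁻¹ = I M I⁻¹`, with `I = I_{p,q}` its own inverse.
  let g : GL (Fin n) ℂ := ⟨Ipq p q h, Ipq p q h, hsq, hsq⟩
  have : phi₂Rep ρ = conjRep g ρ := by
    refine MonoidHom.ext fun γ => ?_
    have h1 : star (ρ γ) * g * ρ γ = g := Units.ext (hρ γ)
    change (star (ρ γ))⁻¹ = g * ρ γ * g⁻¹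
    rw [eq_mul_inv_iff_mul_eq, inv_mul_eq_iff_eq_mul, ← mul_assoc, h1]
  rw [Phi₂_chi, this, chi_conjRep]

end HermitianForm

end CharVar

end


/-! ### The main theorem -/

theorem theorem6p1 {Γ : Type*} [Group Γ] [Group.FG Γ] (n : ℕ) (hn : 1 ≤ n) :
    {x : CharVar.CharacterVariety Γ n | CharVar.Phi₂ x = x} =
      (⋃ (p : ℕ) (q : ℕ) (h : p + q = n),
        CharVar.subgroupCharacterVariety Γ (CharVar.Upq p q h)) ∧
    ∀ ρ : Γ →* GL (Fin n) ℂ, CharVar.IsSemisimple ρ →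
      CharVar.Phi₂ (CharVar.chi ρ) = CharVar.chi ρ →
      ∃ (p q : ℕ) (h : p + q = n) (P : GL (Fin n) ℂ),
        ∀ γ : Γ, P * ρ γ * P⁻¹ ∈ CharVar.Upq p q h := by
  refine ⟨Set.Subset.antisymm (fun x hx => ?_) ?_, fun ρ hρ h => hρ.exists_conj_mem_Upq h⟩
  · obtain ⟨ρ₀, rfl⟩ := CharVar.chi_surjective x
    obtain ⟨ρ, hρ, hχ⟩ := CharVar.exists_isSemisimple_chi_eq ρ₀
    rw [← hχ] at hx ⊢
    obtain ⟨p, q, h, P, hP⟩ := hρ.exists_conj_mem_Upq hx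
    simp only [Set.mem_iUnion]
    refine ⟨p, q, h, (CharVar.conjRep P ρ).codRestrict _ hP, ?_⟩
    exact CharVar.chi_conjRep P ρ
  · refine Set.iUnion_subset fun p => Set.iUnion_subset fun q => Set.iUnion_subset fun h => ?_
    rintro _ ⟨σ, rfl⟩
    exact CharVar.Phi₂_chi_of_mem_Upq h fun γ => (σ γ).2
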